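/- Let $(S_t,\ t\ge 0)$ be a subordinator on a probability space, with zero drift, no killing, and Lévy measure $\nu$ on $(0,\infty)$: that is, $S_0=0$, the paths are almost surely nondecreasing and right-continuous, the increments are stationary and independent, $\int \min(1,y)\,\nu(dy)<\infty$, and $$\mathbb{E}\,e^{-sS_t}=\exp\Big(-t\int_{(0,\infty)}(1-e^{-sy})\,\nu(dy)\Big)\qquad (s,t\ge 0).$$ Let $0<\alpha\le 1$, let $\ell$ be slowly varying at $\infty$, and assume that $\nu$ satisfies $$(1)\qquad \nu[y,\infty)=\ell(1/y)\,y^{-\alpha}\quad\text{for all sufficiently small } y>0 .$$ Consider the multiplicative subordinator $\tilde S_t=1-\exp(-S_t)$. For $x>0$ and $t\ge 0$ let $\tilde N_x(t)$ be the number of jumps of $\tilde S$ of size at least $x$ in the time interval $[0,t]$, and let $\tilde N_x$ be the number of all jumps of $\tilde S$ of size at least $x$ in $[0,\infty)$. Put $\psi(x)=x^{-\alpha}\ell(1/x)$ and $$L^{(\alpha)}(t)=\int_0^t \exp(-\alpha S_u)\,du,\qquad L^{(\alpha)}=\int_0^\infty \exp(-\alpha S_u)\,du .$$ **Theorem 5.1.**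 Almost surely, $\tilde N_x<\infty$ for all $x>0$ and $L^{(\alpha)}<\infty$. As $x\downarrow 0$, almost surely, $$\frac{\tilde N_x(t)}{\psi(x)}\to L^{(\alpha)}(t)\ \text{ for all } t\ge 0,\qquad \frac{\tilde N_x}{\psi(x)}\to L^{(\alpha)} .$$ Both convergences also hold in the mean, the first for each fixed $t\ge0$: the random variables $\tilde N_x(t)$, $\tilde N_x$ (for each $x>0$), $L^{(\alpha)}(t)$ and $L^{(\alpha)}$ are integrable, and, as $x\downarrow 0$, $$\mathbb{E}\left|\frac{\tilde N_x(t)}{\psi(x)}-L^{(\alpha)}(t)\right|\to 0,\qquad \mathbb{E}\left|\frac{\tilde N_x}{\psi(x)}-L^{(\alpha)}\right|\to 0 .$$ -/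

import Mathlib

open MeasureTheory ProbabilityTheory Set Filter Topology
open scoped NNReal ENNReal

noncomputable section

namespace GapCount

/-- `ℓ` is slowly varying at infinity: on some half-line `[X, ∞)` it is positive and measurable,
and `ℓ (c * x) / ℓ x → 1` as `x → ∞` for every `c > 0`. -/
structure IsSlowlyVarying (ℓ : ℝ → ℝ) : Prop where
  pos_measurable : ∃ X : ℝ, (∀ x, X ≤ x → 0 < ℓ x) ∧ Measurable (fun x : Ici X => ℓ x)
  tendsto_ratio : ∀ c : ℝ, 0 < c → Tendsto (fun x => ℓ (c * x) / ℓ x) atTop (𝓝 1)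

/-- `ν` is a Lévy measure of a subordinator without killing: a measure on `(0, ∞)` such that
`∫ min (1, y) ν(dy) < ∞`. -/
structure IsLevyMeasure (ν : Measure ℝ) : Prop where
  null_Iic : ν (Iic 0) = 0
  lintegral_min_lt_top : ∫⁻ y, ENNReal.ofReal (min 1 y) ∂ν < ∞

/-- The Laplace exponent `Φ(s) = ∫ (1 - e^{-s y}) ν(dy)` (zero drift, no killing). -/
def laplaceExponent (ν : Measure ℝ) (s : ℝ) : ℝ :=
  ∫ y, (1 - Real.exp (-s * y)) ∂ν

/-- `S` is a subordinator with drift coefficient `0` and Lévy measure `ν`: it starts at `0`, has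
stationary independent increments, its paths are almost surely nondecreasing and right-continuous,
and `E[exp (-s S_t)] = exp (-t Φ(s))` for `s, t ≥ 0`. -/
structure IsSubordinator {Ω : Type*} [MeasurableSpace Ω] (S : ℝ≥0 → Ω → ℝ) (ν : Measure ℝ)
    (P : Measure Ω) : Prop where
  measurable : ∀ t, Measurable (S t)
  levyMeasure : IsLevyMeasure ν
  start_zero : ∀ᵐ ω ∂P, S 0 ω = 0
  monotone : ∀ᵐ ω ∂P, Monotone fun t => S t ω
  right_continuous : ∀ᵐ ω ∂P, ∀ t, ContinuousWithinAt (fun u => S u ω) (Ici t) t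
  indep_increments : HasIndepIncrements S P
  stationary_increments : ∀ r h : ℝ≥0,
    IdentDistrib (fun ω => S (r + h) ω - S r ω) (S h) P P
  laplace : ∀ (t : ℝ≥0) (s : ℝ), 0 ≤ s →
    ∫ ω, Real.exp (-s * S t ω) ∂P = Real.exp (-(t : ℝ) * laplaceExponent ν s)

/-- The Lévy measure has a regularly varying tail at `0`: for all sufficiently small `y > 0`,
`ν [y, ∞) = ℓ (1 / y) * y ^ (-α)`, where `0 < α ≤ 1` and `ℓ` is slowly varying at infinity. -/
structure HasRegVaryingTail (ν : Measure ℝ) (α : ℝ) (ℓ : ℝ → ℝ) : Prop where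
  index_pos : 0 < α
  index_le_one : α ≤ 1
  slowlyVarying : IsSlowlyVarying ℓ
  tail_eq : ∀ᶠ y in 𝓝[>] (0 : ℝ), ν.real (Ici y) = ℓ (1 / y) * y ^ (-α)

/-- The scaling function `ψ(x) = x ^ (-α) * ℓ (1 / x)`. -/
def scaling (α : ℝ) (ℓ : ℝ → ℝ) (x : ℝ) : ℝ :=
  x ^ (-α) * ℓ (1 / x)

/-- The multiplicative subordinator `1 - exp (-S_t)`. -/
def multiplicative {Ω : Type*} (S : ℝ≥0 → Ω → ℝ) (t : ℝ≥0) (ω : Ω) : ℝ :=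
  1 - Real.exp (-S t ω)

/-- The times at which the path `f` has a jump `f s - f (s-)` of size at least `x`.
(At `s = 0` the value of `leftLim` is `f 0`, so that there is no jump.) -/
def jumpTimes (f : ℝ≥0 → ℝ) (x : ℝ) : Set ℝ≥0 :=
  {s | x ≤ f s - Function.leftLim f s}

/-- The number of jumps of size at least `x` of the multiplicative subordinator restricted to the
time interval `[0, t]`. -/
def jumpCountUpTo {Ω : Type*} (S : ℝ≥0 → Ω → ℝ) (x : ℝ) (t : ℝ≥0) (ω : Ω) : ℕ :=
  (jumpTimes (fun s => multiplicative S s ω) x ∩ Iic t).ncard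

/-- The number of all jumps of size at least `x` of the multiplicative subordinator. -/
def jumpCount {Ω : Type*} (S : ℝ≥0 → Ω → ℝ) (x : ℝ) (ω : Ω) : ℕ :=
  (jumpTimes (fun s => multiplicative S s ω) x).ncard

/-- `L^{(α)}(t) = ∫_0^t exp (-α S_u) du`. -/
def areaUpTo {Ω : Type*} (S : ℝ≥0 → Ω → ℝ) (α : ℝ) (t : ℝ≥0) (ω : Ω) : ℝ :=
  ∫ u in (0 : ℝ)..t, Real.exp (-α * S u.toNNReal ω)

/-- `L^{(α)} = ∫_0^∞ exp (-α S_u) du`. -/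
def area {Ω : Type*} (S : ℝ≥0 → Ω → ℝ) (α : ℝ) (ω : Ω) : ℝ :=
  ∫ u in Ioi (0 : ℝ), Real.exp (-α * S u.toNNReal ω)

/-- `X x → Y` in the mean (in `L¹`) as `x ↓ 0`; all the variables involved are integrable. -/
def TendstoInMean {Ω : Type*} [MeasurableSpace Ω] (X : ℝ → Ω → ℝ) (Y : Ω → ℝ)
    (P : Measure Ω) : Prop :=
  (∀ x, 0 < x → Integrable (X x) P) ∧ Integrable Y P ∧
    Tendsto (fun x => ∫ ω, |X x ω - Y ω| ∂P) (𝓝[>] 0) (𝓝 0)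

end GapCount

end

noncomputable section

namespace GapCount

/-! Write G(y) = ν[y, ∞). For small y, about (b - a) G(y) jumps of S in (a, b] have size at least y.
The map 1 - exp(-·) shrinks a small jump at time u by a factor of about exp(-S_u), so the jump is
counted when its size exceeds about x exp(S_u). Regular variation gives G(x exp(S_u)) ~ exp(-α S_u)
G(x), and summing over u produces the area.

The law of large numbers for S uses neither a Lévy-Itô decomposition nor a Poisson random measure.
Jumps are read off increments: on a fine grid, the cells with increment at least y are as many as
the jumps (`eventually_cellCount_eq`). The cell indicators are independent and identically
distributed, so the variance of the cell count is at most its mean. Since n times the law of S_{h/n}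
approaches hν (`tendsto_integral_continuous`), a subsequential limit of the means lies between the
values of hG just above and just below y. Fatou's lemma carries the variance bound over to the jump
count (`exists_lintegral_jumpsIn_sub_sq_le`). Along y = r^n the normalized squared deviations have
summable expectations, hence tend to 0 almost surely; monotonicity in y fills the gaps and r → 1
closes them (`ae_tendsto_jumpsIn_div`).

On a bounded interval the passage to 1 - exp(-S) is a comparison of Riemann sums
(`tendsto_jumpsIn_expPath`). On [0, ∞) the unit intervals (k, k + 1] must be dominated summably. A
Potter bound supplies the weight exp(-(α/2) S_k); it is independent of the increments after k and
its mean is q^k with q < 1 (`exists_dominating`). The resulting integrable sum serves both the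
almost sure limit of the series and the convergence in the mean. -/

/-- The number of jumps of size at least `y` of the path `f` in `(a, b]`. -/
def jumpsIn (f : ℝ≥0 → ℝ) (y : ℝ) (a b : ℝ≥0) : ℕ := (jumpTimes f y ∩ Ioc a b).ncard

/-- The points of the partition of `[a, a + h]` into `n` intervals of equal length. -/
def gridPoint (a h : ℝ≥0) (n i : ℕ) : ℝ≥0 := a + h * (i / n)

/-- The number of cells of the partition of `(a, a + h]` into `n` equal intervals in which `f`
increases by at least `y`. -/
def cellCount (f : ℝ≥0 → ℝ) (y : ℝ) (a h : ℝ≥0) (n : ℕ) : ℕ :=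
  ((Finset.range n).filter fun i => y ≤ f (gridPoint a h n (i + 1)) - f (gridPoint a h n i)).card

/-! ### Jumps of a monotone right-continuous path, and their detection on a grid -/

section Path

variable {f : ℝ≥0 → ℝ}

/-- Induction on the largest jump time. Ending at the left limit of `c` leaves a possible jump at
`c` unspent, which is what lets the next jump be added. -/
lemma card_mul_le_leftLim_sub (hf : Monotone f) {y : ℝ} {a : ℝ≥0} (F : Finset ℝ≥0) :
    (∀ u ∈ F, a < u ∧ u ∈ jumpTimes f y) → ∀ c, a < c → (∀ u ∈ F, u < c) →
      F.card * y ≤ Function.leftLim f c - f a := by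
  induction F using Finset.induction_on_max with
  | empty =>
    intro _ c hc _
    simpa using hf.le_leftLim hc
  | insert m F hm ih =>
    intro h c hc hlt
    have hmF : m ∉ F := fun h' => lt_irrefl _ (hm m h')
    have h1 := ih (fun u hu => h u (Finset.mem_insert_of_mem hu)) m
      (h m (Finset.mem_insert_self _ _)).1 hm
    have h2 : y ≤ f m - Function.leftLim f m := (h m (Finset.mem_insert_self _ _)).2
    have h3 := hf.le_leftLim (hlt m (Finset.mem_insert_self _ _))
    rw [Finset.card_insert_of_notMem hmF]
    push_cast
    linarith

lemma card_mul_le_sub (hf : Monotone f) {y : ℝ} {a b : ℝ≥0} {F : Finset ℝ≥0} (hab : a ≤ b)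
    (hF : (F : Set ℝ≥0) ⊆ jumpTimes f y ∩ Ioc a b) : F.card * y ≤ f b - f a := by
  induction F using Finset.induction_on_max with
  | empty => simpa using hf hab
  | insert m F hm ih =>
    have hmF : m ∉ F := fun h' => lt_irrefl _ (hm m h')
    have hm' := hF (Finset.mem_insert_self m F)
    have h1 := card_mul_le_leftLim_sub hf F (y := y) (a := a)
      (fun u hu => ⟨(hF (Finset.mem_insert_of_mem hu)).2.1, (hF (Finset.mem_insert_of_mem hu)).1⟩)
      m hm'.2.1 hm
    have h2 : y ≤ f m - Function.leftLim f m := hm'.1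
    have h3 := hf hm'.2.2
    rw [Finset.card_insert_of_notMem hmF]
    push_cast
    linarith

lemma finite_jumpTimes_inter_Ioc (hf : Monotone f) {y : ℝ} (hy : 0 < y) (a b : ℝ≥0) :
    (jumpTimes f y ∩ Ioc a b).Finite := by
  rcases le_or_gt b a with hab | hab
  · simp [Ioc_eq_empty (not_lt.2 hab)]
  by_contra h
  obtain ⟨F, hF, hc⟩ := Set.Infinite.exists_subset_card_eq h (⌊(f b - f a) / y⌋₊ + 1)
  have h1 := card_mul_le_sub hf hab.le hF
  rw [hc] at h1
  have h2 := Nat.lt_floor_add_one ((f b - f a) / y)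
  rw [div_lt_iff₀ hy] at h2
  push_cast at h1
  linarith

lemma jumpsIn_mul_le (hf : Monotone f) {y : ℝ} (hy : 0 < y) {a b : ℝ≥0} (hab : a ≤ b) :
    jumpsIn f y a b * y ≤ f b - f a := by
  have h := finite_jumpTimes_inter_Ioc hf hy a b
  have := card_mul_le_sub hf hab (F := h.toFinset) (y := y) (by simp)
  rwa [← Set.ncard_eq_toFinset_card _ h] at this

lemma jumpsIn_add (hf : Monotone f) {y : ℝ} (hy : 0 < y) {a b c : ℝ≥0} (hab : a ≤ b)
    (hbc : b ≤ c) : jumpsIn f y a b + jumpsIn f y b c = jumpsIn f y a c := by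
  unfold jumpsIn
  rw [← Set.ncard_union_eq _ (finite_jumpTimes_inter_Ioc hf hy _ _)
    (finite_jumpTimes_inter_Ioc hf hy _ _), ← inter_union_distrib_left, Ioc_union_Ioc_eq_Ioc hab hbc]
  refine Set.disjoint_left.2 fun u hu hu' => ?_
  exact absurd hu.2.2 (not_le.2 hu'.2.1)

lemma jumpsIn_anti (hf : Monotone f) {x y : ℝ} (hx : 0 < x) (hxy : x ≤ y) (a b : ℝ≥0) :
    jumpsIn f y a b ≤ jumpsIn f x a b :=
  Set.ncard_le_ncard (fun _ hu => ⟨hxy.trans hu.1, hu.2⟩) (finite_jumpTimes_inter_Ioc hf hx a b)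

lemma gridPoint_mono (a h : ℝ≥0) (n : ℕ) : Monotone (gridPoint a h n) := by
  intro i j hij
  unfold gridPoint
  gcongr

@[simp] lemma gridPoint_zero (a h : ℝ≥0) (n : ℕ) : gridPoint a h n 0 = a := by simp [gridPoint]

lemma gridPoint_self (a h : ℝ≥0) {n : ℕ} (hn : n ≠ 0) : gridPoint a h n n = a + h := by
  simp [gridPoint, hn]

lemma gridPoint_succ (a h : ℝ≥0) (n i : ℕ) :
    gridPoint a h n (i + 1) = gridPoint a h n i + h / n := by
  simp only [gridPoint, Nat.cast_add, Nat.cast_one, add_div, mul_add, mul_one_div, add_assoc]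

/-- Near each point, a cell without jump of size at least `y` has increment less than `y`. -/
lemma exists_ball_increment (hf : Monotone f) (hr : ∀ t, ContinuousWithinAt f (Ici t) t) {y : ℝ}
    (hy : 0 < y) (u : ℝ≥0) : ∃ ε > 0, ∀ c d, c ∈ Metric.ball u ε → d ∈ Metric.ball u ε → c < d →
      y ≤ f d - f c → u ∈ Ioc c d ∧ u ∈ jumpTimes f y := by
  set J := f u - Function.leftLim f u with hJ
  have hJ0 : 0 ≤ J := sub_nonneg.2 (hf.leftLim_le le_rfl)
  -- Close to `u` the increments on one side of `u` are at most `η`, and those across `u` are below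
  -- `J + 2 * η`.
  obtain ⟨η, hη, hη1, hη2⟩ : ∃ η > 0, η < y / 2 ∧ (J < y → J + 2 * η < y) := by
    by_cases h : J < y
    · refine ⟨(y - J) / 4, by linarith, by linarith, fun _ => by linarith⟩
    · exact ⟨y / 4, by linarith, by linarith, fun h' => absurd h' h⟩
  have h1 : ∀ᶠ v in 𝓝[≥] u, f v < f u + η :=
    (hr u).eventually (gt_mem_nhds (by linarith : f u < f u + η))
  have h2 : ∀ᶠ v in 𝓝[<] u, Function.leftLim f u - η < f v :=
    (hf.tendsto_leftLim u).eventually (lt_mem_nhds (by linarith))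
  rw [eventually_nhdsWithin_iff, Metric.eventually_nhds_iff] at h1 h2
  obtain ⟨e1, he1, h1⟩ := h1
  obtain ⟨e2, he2, h2⟩ := h2
  refine ⟨min e1 e2, lt_min he1 he2, fun c d hc hd hcd hinc => ?_⟩
  have hc2 := fun h => h2 (lt_of_lt_of_le hc (min_le_right _ _)) h
  have hd1 := fun h => h1 (lt_of_lt_of_le hd (min_le_left _ _)) h
  rcases le_or_gt u c with huc | huc
  · exfalso
    have := hd1 (huc.trans hcd.le)
    have := hf huc
    linarith
  rcases lt_or_ge d u with hdu | hdu
  · exfalso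
    have := hc2 huc
    have := hf.le_leftLim hdu
    linarith
  · refine ⟨⟨huc, hdu⟩, ?_⟩
    by_contra hcon
    have hcon' : J < y := not_le.1 hcon
    have := hc2 huc
    have := hd1 hdu
    have := hη2 hcon'
    linarith

lemma exists_mem_Ioc_gridPoint {a h : ℝ≥0} {n : ℕ} (hn : n ≠ 0) {u : ℝ≥0}
    (hu : u ∈ Ioc a (a + h)) : ∃ i < n, u ∈ Ioc (gridPoint a h n i) (gridPoint a h n (i + 1)) := by
  have hex : ∃ i, u ≤ gridPoint a h n (i + 1) :=
    ⟨n, hu.2.trans ((gridPoint_self a h hn).ge.trans (gridPoint_mono a h n (Nat.le_succ n)))⟩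
  classical
  refine ⟨Nat.find hex, ?_, ?_, Nat.find_spec hex⟩
  · have : Nat.find hex ≤ n - 1 := by
      refine Nat.find_min' hex ?_
      rw [Nat.sub_add_cancel (Nat.pos_of_ne_zero hn), gridPoint_self a h hn]
      exact hu.2
    omega
  · rcases Nat.eq_zero_or_pos (Nat.find hex) with h0 | h0
    · rw [h0, gridPoint_zero]; exact hu.1
    · have := Nat.find_min hex (Nat.sub_one_lt h0.ne')
      rwa [Nat.sub_one_add_one h0.ne', not_le] at this

lemma dist_lt_of_mem_cell {a h : ℝ≥0} {n i : ℕ} {u v : ℝ≥0}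
    (hu : u ∈ Icc (gridPoint a h n i) (gridPoint a h n (i + 1)))
    (hv : v ∈ Icc (gridPoint a h n i) (gridPoint a h n (i + 1))) : dist u v ≤ h / n := by
  rw [gridPoint_succ] at hu hv
  have h1 : ((gridPoint a h n i : ℝ≥0) : ℝ) ≤ u := by exact_mod_cast hu.1
  have h2 : ((gridPoint a h n i : ℝ≥0) : ℝ) ≤ v := by exact_mod_cast hv.1
  have h3 : (u : ℝ) ≤ gridPoint a h n i + h / n := by exact_mod_cast hu.2
  have h4 : (v : ℝ) ≤ gridPoint a h n i + h / n := by exact_mod_cast hv.2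
  rw [NNReal.dist_eq, abs_le]
  constructor <;> linarith

/-- For a monotone right-continuous path, the number of cells of a fine partition in which the path
increases by at least `y` is the number of jumps of size at least `y`. -/
lemma eventually_cellCount_eq (hf : Monotone f) (hr : ∀ t, ContinuousWithinAt f (Ici t) t) {y : ℝ}
    (hy : 0 < y) (a h : ℝ≥0) : ∀ᶠ n in atTop, cellCount f y a h n = jumpsIn f y a (a + h) := by
  have hT := finite_jumpTimes_inter_Ioc hf hy a (a + h)
  choose ε hε hball using exists_ball_increment hf hr hy
  -- A mesh below the Lebesgue number puts each cell into one of the balls, so a cell with a large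
  -- increment contains a large jump. A mesh below the distances between the finitely many jump
  -- times leaves at most one of them in a cell.
  obtain ⟨δ, hδ, hleb⟩ := lebesgue_number_lemma_of_metric (isCompact_Icc (a := a) (b := a + h))
    (c := fun u => Metric.ball u (ε u)) (fun _ => Metric.isOpen_ball)
    (fun u _ => mem_iUnion.2 ⟨u, Metric.mem_ball_self (hε u)⟩)
  have hmesh : Tendsto (fun n : ℕ => (h : ℝ) / n) atTop (𝓝 0) :=
    tendsto_const_div_atTop_nhds_zero_nat _
  have hsep : ∀ᶠ n : ℕ in atTop, ∀ u ∈ hT.toFinset, ∀ v ∈ hT.toFinset, u ≠ v →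
      (h : ℝ) / n < dist u v := by
    rw [Filter.eventually_all_finset]
    intro u _
    rw [Filter.eventually_all_finset]
    intro v _
    by_cases huv : u = v
    · simp [huv]
    · filter_upwards [hmesh.eventually (gt_mem_nhds (dist_pos.2 huv))] with n hn _ using hn
  filter_upwards [hmesh.eventually (gt_mem_nhds hδ), hsep, eventually_gt_atTop 0] with n hn1 hn2 hn0
  have hn0' : n ≠ 0 := hn0.ne'
  unfold jumpsIn cellCount
  rw [Set.ncard_eq_toFinset_card _ hT]
  symm
  have hex : ∀ u (hu : u ∈ hT.toFinset), ∃ i < n,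
      u ∈ Ioc (gridPoint a h n i) (gridPoint a h n (i + 1)) := fun u hu =>
    exists_mem_Ioc_gridPoint hn0' ((hT.mem_toFinset.1 hu).2)
  choose! I hI1 hI2 using hex
  refine Finset.card_bij (fun u _ => I u) ?_ ?_ ?_
  · intro u hu
    have hj : y ≤ f u - Function.leftLim f u := (hT.mem_toFinset.1 hu).1
    simp only [Finset.mem_filter, Finset.mem_range]
    refine ⟨hI1 u hu, ?_⟩
    have h1 := hf (hI2 u hu).2
    have h2 := hf.le_leftLim (hI2 u hu).1
    linarith
  · intro u hu v hv huv
    by_contra hne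
    have h1 := hn2 u hu v hv hne
    have h2 := dist_lt_of_mem_cell (Ioc_subset_Icc_self (hI2 u hu))
      (Ioc_subset_Icc_self (huv ▸ hI2 v hv))
    linarith
  · intro i hi
    simp only [Finset.mem_filter, Finset.mem_range] at hi
    obtain ⟨hi1, hi2⟩ := hi
    have hle := gridPoint_mono a h n (Nat.le_succ i)
    have hlt : gridPoint a h n i < gridPoint a h n (i + 1) := by
      refine lt_of_le_of_ne hle fun heq => ?_
      rw [← heq] at hi2
      linarith
    have hgi : gridPoint a h n i ∈ Icc a (a + h) :=
      ⟨by simpa using gridPoint_mono a h n (Nat.zero_le i),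
        by simpa [gridPoint_self a h hn0'] using gridPoint_mono a h n hi1.le⟩
    have hgi' : gridPoint a h n (i + 1) ≤ a + h := by
      simpa [gridPoint_self a h hn0'] using gridPoint_mono a h n (Nat.succ_le_of_lt hi1)
    obtain ⟨u, hu⟩ := hleb _ hgi
    have hd : gridPoint a h n (i + 1) ∈ Metric.ball (gridPoint a h n i) δ :=
      lt_of_le_of_lt (dist_lt_of_mem_cell (right_mem_Icc.2 hle) (left_mem_Icc.2 hle)) hn1
    obtain ⟨hu1, hu2⟩ := hball u _ _ (hu (Metric.mem_ball_self hδ)) (hu hd) hlt hi2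
    have huT : u ∈ hT.toFinset :=
      hT.mem_toFinset.2 ⟨hu2, lt_of_le_of_lt hgi.1 hu1.1, hu1.2.trans hgi'⟩
    refine ⟨u, huT, ?_⟩
    have h3 := hI2 u huT
    by_contra hne
    rcases lt_or_gt_of_ne hne with hlt' | hlt'
    · have := gridPoint_mono a h n (Nat.succ_le_of_lt hlt')
      exact absurd (h3.2.trans this) (not_le.2 hu1.1)
    · have := gridPoint_mono a h n (Nat.succ_le_of_lt hlt')
      exact absurd (hu1.2.trans this) (not_le.2 h3.1)

end Path

/-! ### Deterministic comparison of the jumps of `f` and of `1 - exp (-f)` -/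

section Multiplicative

variable {f : ℝ≥0 → ℝ}

/-- The multiplicative path `1 - exp (-f)`. -/
def expPath (f : ℝ≥0 → ℝ) (s : ℝ≥0) : ℝ := 1 - Real.exp (-f s)

lemma expPath_mono (hf : Monotone f) : Monotone (expPath f) := fun s t hst => by
  have := Real.exp_le_exp.2 (neg_le_neg (hf hst))
  unfold expPath
  linarith

lemma expPath_right_continuous (hr : ∀ t, ContinuousWithinAt f (Ici t) t) (t : ℝ≥0) :
    ContinuousWithinAt (expPath f) (Ici t) t :=
  (hr t).neg.rexp.const_sub 1

lemma leftLim_expPath (hf : Monotone f) (u : ℝ≥0) :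
    Function.leftLim (expPath f) u = 1 - Real.exp (-Function.leftLim f u) := by
  -- With no points to the left of `u`, both left limits are by convention the values at `u`.
  by_cases h : 𝓝[<] u = ⊥
  · rw [leftLim_eq_of_eq_bot _ h, leftLim_eq_of_eq_bot _ h, expPath]
  · have : (𝓝[<] u).NeBot := ⟨h⟩
    exact leftLim_eq_of_tendsto
      (((Real.continuous_exp.tendsto _).comp (hf.tendsto_leftLim u).neg).const_sub 1)

/-- A jump of size J starting from height p becomes one of size exp(-p)(1 - exp(-J)) ≤ exp(-f a) J.
-/
lemma jumpsIn_expPath_le (hf : Monotone f) {x : ℝ} (hx : 0 < x) (a b : ℝ≥0) :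
    jumpsIn (expPath f) x a b ≤ jumpsIn f (x * Real.exp (f a)) a b := by
  refine Set.ncard_le_ncard (fun u hu => ⟨?_, hu.2⟩)
    (finite_jumpTimes_inter_Ioc hf (by positivity) a b)
  have h1 : x ≤ expPath f u - Function.leftLim (expPath f) u := hu.1
  rw [leftLim_expPath hf, expPath] at h1
  have h2 := hf.le_leftLim hu.2.1
  have h3 := Real.add_one_le_exp (-(f u - Function.leftLim f u))
  have h4 : Real.exp (-f u) =
      Real.exp (-Function.leftLim f u) * Real.exp (-(f u - Function.leftLim f u)) := by
    rw [← Real.exp_add]; ring_nf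
  have h6 : 0 ≤ f u - Function.leftLim f u := sub_nonneg.2 (hf.leftLim_le le_rfl)
  have h5 : Real.exp (-Function.leftLim f u) ≤ Real.exp (-f a) := Real.exp_le_exp.2 (by linarith)
  have h7 : x ≤ Real.exp (-f a) * (f u - Function.leftLim f u) := by
    have := Real.exp_pos (-Function.leftLim f u)
    calc x ≤ Real.exp (-Function.leftLim f u) *
          (1 - Real.exp (-(f u - Function.leftLim f u))) := by rw [mul_sub, ← h4]; linarith
      _ ≤ Real.exp (-Function.leftLim f u) * (f u - Function.leftLim f u) :=
        mul_le_mul_of_nonneg_left (by linarith) this.le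
      _ ≤ _ := by gcongr
  show x * Real.exp (f a) ≤ f u - Function.leftLim f u
  rw [Real.exp_neg, inv_mul_eq_div, le_div_iff₀ (Real.exp_pos _)] at h7
  exact h7

/-- A jump of size J ending at height p becomes one of size exp(-p)(exp J - 1) ≥ exp(-f b) J. -/
lemma le_jumpsIn_expPath (hf : Monotone f) {x : ℝ} (hx : 0 < x) (a b : ℝ≥0) :
    jumpsIn f (x * Real.exp (f b)) a b ≤ jumpsIn (expPath f) x a b := by
  refine Set.ncard_le_ncard (fun u hu => ⟨?_, hu.2⟩)
    (finite_jumpTimes_inter_Ioc (expPath_mono hf) hx a b)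
  have h1 : x * Real.exp (f b) ≤ f u - Function.leftLim f u := hu.1
  show x ≤ expPath f u - Function.leftLim (expPath f) u
  rw [leftLim_expPath hf, expPath]
  have h2 := hf hu.2.2
  have h3 := Real.add_one_le_exp (f u - Function.leftLim f u)
  have h4 : Real.exp (-Function.leftLim f u) =
      Real.exp (-f u) * Real.exp (f u - Function.leftLim f u) := by
    rw [← Real.exp_add]; ring_nf
  have h5 : Real.exp (-f b) ≤ Real.exp (-f u) := Real.exp_le_exp.2 (by linarith)
  have h6 : 0 ≤ f u - Function.leftLim f u := sub_nonneg.2 (hf.leftLim_le le_rfl)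
  calc x = Real.exp (-f b) * (x * Real.exp (f b)) := by
        rw [mul_left_comm, ← Real.exp_add]; simp
    _ ≤ Real.exp (-f u) * (f u - Function.leftLim f u) := by gcongr
    _ ≤ Real.exp (-f u) * (Real.exp (f u - Function.leftLim f u) - 1) :=
        mul_le_mul_of_nonneg_left (by linarith) (Real.exp_pos _).le
    _ = _ := by rw [mul_sub, ← h4]; ring

/-- After time `a` the path 1 - exp(-f) has less than exp(-f a) < x left to climb. -/
lemma jumpsIn_expPath_eq_zero (hf : Monotone f) {x : ℝ} {a : ℝ≥0} (b : ℝ≥0)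
    (hx : 1 < x * Real.exp (f a)) : jumpsIn (expPath f) x a b = 0 := by
  have hx0 : 0 < x := by
    by_contra h
    have := mul_nonpos_of_nonpos_of_nonneg (not_lt.1 h) (Real.exp_pos (f a)).le
    linarith
  rcases le_total b a with hab | hab
  · simp [jumpsIn, Ioc_eq_empty (not_lt.2 hab)]
  by_contra h
  have h1 := jumpsIn_mul_le (expPath_mono hf) hx0 hab
  have h2 : (1 : ℝ) ≤ jumpsIn (expPath f) x a b := by exact_mod_cast Nat.one_le_iff_ne_zero.2 h
  have h3 : x ≤ expPath f b - expPath f a := by nlinarith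
  have h4 : x < Real.exp (-f a) := by
    have := Real.exp_pos (-f b)
    unfold expPath at h3
    linarith
  have h5 : x * Real.exp (f a) < Real.exp (-f a) * Real.exp (f a) := by gcongr
  rw [← Real.exp_add] at h5
  simp at h5
  linarith

lemma expPath_sub_le_one (h0 : ∀ t, 0 ≤ f t) (a b : ℝ≥0) : expPath f b - expPath f a ≤ 1 := by
  have h1 : Real.exp (-f a) ≤ 1 := Real.exp_le_one_iff.2 (by linarith [h0 a])
  have := Real.exp_pos (-f b)
  unfold expPath
  linarith

lemma jumpTimes_expPath_subset {x : ℝ} (hx : 0 < x) :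
    jumpTimes (expPath f) x ⊆ Ioi 0 := by
  intro u hu
  rcases eq_or_lt_of_le (zero_le : (0:ℝ≥0) ≤ u) with h | h
  · exfalso
    have h1 : x ≤ expPath f u - Function.leftLim (expPath f) u := hu
    rw [leftLim_eq_of_isBot (by rw [← h]; exact isBot_bot)] at h1
    linarith
  · exact h

/-- The total height available is at most 1 and each jump uses up at least `x` of it. -/
lemma finite_jumpTimes_expPath (hf : Monotone f) (h0 : ∀ t, 0 ≤ f t) {x : ℝ} (hx : 0 < x) :
    (jumpTimes (expPath f) x).Finite := by
  by_contra h
  obtain ⟨F, hF, hc⟩ := Set.Infinite.exists_subset_card_eq h (⌊1 / x⌋₊ + 1)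
  have hF' : (F : Set ℝ≥0) ⊆ jumpTimes (expPath f) x ∩ Ioc 0 (F.sup id) := fun u hu =>
    ⟨hF hu, jumpTimes_expPath_subset hx (hF hu), Finset.le_sup (f := id) hu⟩
  have h1 := card_mul_le_sub (expPath_mono hf) zero_le hF'
  have h2 := Nat.lt_floor_add_one (1 / x)
  rw [div_lt_iff₀ hx] at h2
  have h3 := expPath_sub_le_one h0 0 (F.sup id)
  rw [hc] at h1
  push_cast at h1
  linarith

lemma eventually_jumpsIn_expPath_eq (hf : Monotone f) (h0 : ∀ t, 0 ≤ f t) {x : ℝ} (hx : 0 < x) :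
    ∀ᶠ k : ℕ in atTop, jumpsIn (expPath f) x 0 k = (jumpTimes (expPath f) x).ncard := by
  obtain ⟨B, hB⟩ := (finite_jumpTimes_expPath hf h0 hx).bddAbove
  obtain ⟨K, hK⟩ := exists_nat_ge B
  filter_upwards [eventually_ge_atTop K] with k hk
  unfold jumpsIn
  congr 1
  refine inter_eq_left.2 fun u hu => ⟨jumpTimes_expPath_subset hx hu, (hB hu).trans (hK.trans ?_)⟩
  exact_mod_cast hk

lemma ncard_jumpTimes_expPath_mul_le (hf : Monotone f) (h0 : ∀ t, 0 ≤ f t) {x : ℝ} (hx : 0 < x) :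
    (jumpTimes (expPath f) x).ncard * x ≤ 1 := by
  obtain ⟨k, hk⟩ := (eventually_jumpsIn_expPath_eq hf h0 hx).exists
  rw [← hk]
  exact (jumpsIn_mul_le (expPath_mono hf) hx zero_le).trans (expPath_sub_le_one h0 _ _)

lemma ncard_jumpTimes_expPath_inter_Iic {x : ℝ} (hx : 0 < x) (t : ℝ≥0) :
    (jumpTimes (expPath f) x ∩ Iic t).ncard = jumpsIn (expPath f) x 0 t := by
  unfold jumpsIn
  congr 1
  ext u
  simp only [mem_inter_iff, mem_Iic, mem_Ioc]
  exact ⟨fun h => ⟨h.1, jumpTimes_expPath_subset hx h.1, h.2⟩, fun h => ⟨h.1, h.2.2⟩⟩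

end Multiplicative

/-! ### Integrability with respect to the Lévy measure -/

section LevyMeasure

variable {ν : Measure ℝ}

lemma IsLevyMeasure.ae_pos (hν : IsLevyMeasure ν) : ∀ᵐ y ∂ν, 0 < y := by
  rw [ae_iff]
  convert hν.null_Iic using 2
  ext y
  simp

lemma IsLevyMeasure.integrable_min (hν : IsLevyMeasure ν) : Integrable (fun y => min 1 y) ν := by
  have hm : Measurable (fun y : ℝ => min 1 y) := measurable_const.min measurable_id
  refine ⟨hm.aestronglyMeasurable, ?_⟩
  rw [hasFiniteIntegral_iff_ofReal]
  · exact hν.lintegral_min_lt_top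
  · filter_upwards [hν.ae_pos] with y hy
    exact le_min zero_le_one hy.le

lemma IsLevyMeasure.measure_Ici_lt_top (hν : IsLevyMeasure ν) {y : ℝ} (hy : 0 < y) :
    ν (Ici y) < ∞ := by
  have := hν.integrable_min.measure_ge_lt_top (ε := min 1 y) (by positivity)
  refine lt_of_le_of_lt (measure_mono fun u hu => ?_) this
  exact min_le_min le_rfl (mem_Ici.1 hu)

lemma IsLevyMeasure.integrable_one_sub_exp (hν : IsLevyMeasure ν) {s : ℝ} (hs : 0 ≤ s) :
    Integrable (fun y => 1 - Real.exp (-s * y)) ν := by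
  refine (hν.integrable_min.const_mul (max 1 s)).mono'
    (by fun_prop : Measurable (fun y => 1 - Real.exp (-s * y))).aestronglyMeasurable ?_
  filter_upwards [hν.ae_pos] with y hy
  have h1 : Real.exp (-s * y) ≤ 1 := Real.exp_le_one_iff.2 (by nlinarith)
  rw [Real.norm_of_nonneg (by linarith)]
  have h2 := Real.add_one_le_exp (-s * y)
  have h3 := Real.exp_pos (-s * y)
  rcases min_cases 1 y with h | h <;> rw [h.1]
  · have := le_max_left 1 s; linarith
  · have := le_max_right 1 s
    nlinarith

lemma IsLevyMeasure.integral_exp_mul (hν : IsLevyMeasure ν) (k : ℕ) :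
    Integrable (fun x => Real.exp (-x) ^ k * (1 - Real.exp (-x))) ν ∧
    ∫ x, Real.exp (-x) ^ k * (1 - Real.exp (-x)) ∂ν =
      laplaceExponent ν (k + 1) - laplaceExponent ν k := by
  have h1 := hν.integrable_one_sub_exp (s := k + 1) (by positivity)
  have h2 := hν.integrable_one_sub_exp (s := k) (by positivity)
  have he : (fun x => Real.exp (-x) ^ k * (1 - Real.exp (-x))) = fun x =>
      (1 - Real.exp (-((k : ℝ) + 1) * x)) - (1 - Real.exp (-(k : ℝ) * x)) := by
    funext x
    have : Real.exp (-((k : ℝ) + 1) * x) = Real.exp (-(k : ℝ) * x) * Real.exp (-x) := by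
      rw [← Real.exp_add]; ring_nf
    rw [this, ← Real.exp_nat_mul]
    ring_nf
  rw [he]
  exact ⟨h1.sub h2, integral_sub h1 h2⟩

end LevyMeasure

lemma IsSubordinator.ae_nonneg {Ω : Type*} [MeasurableSpace Ω] {P : Measure Ω} {S : ℝ≥0 → Ω → ℝ}
    {ν : Measure ℝ} (hS : IsSubordinator S ν P) : ∀ᵐ ω ∂P, ∀ t, 0 ≤ S t ω := by
  filter_upwards [hS.start_zero, hS.monotone] with ω h0 hm t
  rw [← h0]
  exact hm zero_le

/-! ### Small-time behaviour: n times the law of S_{h/n} approaches h ν -/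

section SmallTime

variable {Ω : Type*} [MeasurableSpace Ω] {P : Measure Ω} [IsProbabilityMeasure P]
  {S : ℝ≥0 → Ω → ℝ} {ν : Measure ℝ}

lemma tendsto_nat_mul_exp_sub_one (c : ℝ) :
    Tendsto (fun n : ℕ => (n : ℝ) * (Real.exp (c / n) - 1)) atTop (𝓝 c) := by
  have h : HasDerivAt (fun x : ℝ => Real.exp (c * x)) c 0 := by
    have := ((hasDerivAt_id (0 : ℝ)).const_mul c).exp
    simpa using this
  have h2 := (hasDerivAt_iff_tendsto_slope_zero.1 h).comp
    (tendsto_nhdsWithin_iff.2 ⟨tendsto_inv_atTop_nhds_zero_nat (𝕜 := ℝ), by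
      filter_upwards [eventually_gt_atTop 0] with n hn
      simp [hn.ne']⟩)
  refine h2.congr fun n => ?_
  simp [div_eq_mul_inv]

lemma IsSubordinator.integrable_exp_pow (hS : IsSubordinator S ν P) (t : ℝ≥0) {g : ℝ → ℝ}
    (hg : Continuous g) : Integrable (fun ω => g (Real.exp (-S t ω)) * (1 - Real.exp (-S t ω))) P := by
  obtain ⟨C, hC⟩ := isCompact_Icc.exists_bound_of_continuousOn
    (f := fun z : ℝ => g z * (1 - z)) (s := Icc (0:ℝ) 1) (by fun_prop)
  have hm := hS.measurable t
  have hg' := hg.measurable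
  refine Integrable.of_bound (C := C) (by fun_prop) ?_
  filter_upwards [hS.ae_nonneg] with ω hω
  exact hC _ ⟨(Real.exp_pos _).le, Real.exp_le_one_iff.2 (by linarith [hω t])⟩

lemma IsSubordinator.integral_exp_mul (hS : IsSubordinator S ν P) (t : ℝ≥0) (k : ℕ) :
    ∫ ω, Real.exp (-S t ω) ^ k * (1 - Real.exp (-S t ω)) ∂P =
      Real.exp (-(t : ℝ) * laplaceExponent ν k) - Real.exp (-(t : ℝ) * laplaceExponent ν (k + 1)) := by
  have hm := hS.measurable t
  have hint : ∀ s : ℝ, 0 ≤ s → Integrable (fun ω => Real.exp (-s * S t ω)) P := fun s hs => by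
    refine Integrable.of_bound (C := 1) (by fun_prop) ?_
    filter_upwards [hS.ae_nonneg] with ω hω
    rw [Real.norm_of_nonneg (Real.exp_pos _).le]
    exact Real.exp_le_one_iff.2 (by nlinarith [hω t])
  rw [← hS.laplace t k (by positivity), ← hS.laplace t (k + 1) (by positivity),
    ← integral_sub (hint _ (by positivity)) (hint _ (by positivity))]
  congr 1
  funext ω
  rw [← Real.exp_nat_mul, mul_sub, mul_one, ← Real.exp_add]
  ring_nf

/-- On monomials in exp(-x) both sides are explicit differences of Laplace transforms or exponents,
and the limit is the derivative of exp at 0. The factor 1 - exp(-x) makes everything ν-integrable.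
-/
lemma IsSubordinator.tendsto_integral_polynomial (hS : IsSubordinator S ν P) (h : ℝ≥0)
    (p : Polynomial ℝ) :
    Integrable (fun x => p.eval (Real.exp (-x)) * (1 - Real.exp (-x))) ν ∧
    Tendsto (fun n : ℕ => (n : ℝ) *
      ∫ ω, p.eval (Real.exp (-S (h / n) ω)) * (1 - Real.exp (-S (h / n) ω)) ∂P) atTop
      (𝓝 (h * ∫ x, p.eval (Real.exp (-x)) * (1 - Real.exp (-x)) ∂ν)) := by
  induction p using Polynomial.induction_on' with
  | add p q hp hq =>
    simp only [Polynomial.eval_add, add_mul]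
    refine ⟨hp.1.add hq.1, ?_⟩
    rw [integral_add hp.1 hq.1, mul_add]
    refine (hp.2.add hq.2).congr fun n => ?_
    rw [integral_add (hS.integrable_exp_pow _ p.continuous) (hS.integrable_exp_pow _ q.continuous),
      mul_add]
  | monomial k c =>
    obtain ⟨h1, h2⟩ := hS.levyMeasure.integral_exp_mul k
    simp only [Polynomial.eval_monomial, mul_assoc c, integral_const_mul]
    refine ⟨h1.const_mul c, ?_⟩
    rw [h2]
    have h3 := ((tendsto_nat_mul_exp_sub_one (-h * laplaceExponent ν k)).sub
      (tendsto_nat_mul_exp_sub_one (-h * laplaceExponent ν (k + 1)))).const_mul c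
    have h4 : (h : ℝ) * (c * (laplaceExponent ν (k + 1) - laplaceExponent ν k)) =
      c * (-h * laplaceExponent ν k - -h * laplaceExponent ν (k + 1)) := by ring
    rw [h4]
    refine h3.congr fun n => ?_
    rw [hS.integral_exp_mul]
    push_cast
    rw [show -((h : ℝ) / n) * laplaceExponent ν k = -h * laplaceExponent ν k / n by ring,
      show -((h : ℝ) / n) * laplaceExponent ν (k + 1) = -h * laplaceExponent ν (k + 1) / n by ring]
    ring

/-- Vague convergence of the rescaled laws of `S (h / n)` to the Lévy measure. -/
lemma IsSubordinator.tendsto_integral_continuous (hS : IsSubordinator S ν P) (h : ℝ≥0) {g : ℝ → ℝ}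
    (hg : Continuous g) :
    Integrable (fun x => g (Real.exp (-x)) * (1 - Real.exp (-x))) ν ∧
    Tendsto (fun n : ℕ => (n : ℝ) *
      ∫ ω, g (Real.exp (-S (h / n) ω)) * (1 - Real.exp (-S (h / n) ω)) ∂P) atTop
      (𝓝 (h * ∫ x, g (Real.exp (-x)) * (1 - Real.exp (-x)) ∂ν)) := by
  have hw : Integrable (fun x => 1 - Real.exp (-x)) ν := by
    simpa using hS.levyMeasure.integrable_one_sub_exp zero_le_one
  have hwP : ∀ t, Integrable (fun ω => 1 - Real.exp (-S t ω)) P := fun t => by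
    simpa using hS.integrable_exp_pow t (continuous_const (y := (1 : ℝ)))
  have hone : Tendsto (fun n : ℕ => (n : ℝ) * ∫ ω, (1 - Real.exp (-S (h / n) ω)) ∂P) atTop
      (𝓝 (h * ∫ x, (1 - Real.exp (-x)) ∂ν)) := by
    simpa using (hS.tendsto_integral_polynomial h 1).2
  have hν01 : ∀ᵐ x ∂ν, Real.exp (-x) ∈ Icc (0 : ℝ) 1 := by
    filter_upwards [hS.levyMeasure.ae_pos] with x hx
    exact ⟨(Real.exp_pos _).le, Real.exp_le_one_iff.2 (by linarith)⟩
  have hP01 : ∀ t, ∀ᵐ ω ∂P, Real.exp (-S t ω) ∈ Icc (0 : ℝ) 1 := fun t => by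
    filter_upwards [hS.ae_nonneg] with ω hω
    exact ⟨(Real.exp_pos _).le, Real.exp_le_one_iff.2 (by linarith [hω t])⟩
  have hgint : Integrable (fun x => g (Real.exp (-x)) * (1 - Real.exp (-x))) ν := by
    obtain ⟨C, hC⟩ := isCompact_Icc.exists_bound_of_continuousOn
      (f := g) (s := Icc (0:ℝ) 1) hg.continuousOn
    have hg' := hg.measurable
    refine hw.bdd_mul (c := C) (by fun_prop) ?_
    filter_upwards [hν01] with x hx using hC _ hx
  refine ⟨hgint, ?_⟩
  set K := (h : ℝ) * ∫ x, (1 - Real.exp (-x)) ∂ν with hK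
  have hK0 : 0 ≤ K := by
    refine mul_nonneg h.2 (integral_nonneg_of_ae ?_)
    filter_upwards [hν01] with x hx using sub_nonneg.2 hx.2
  rw [Metric.tendsto_atTop']
  intro ε hε
  -- The three terms pay for replacing `g` by a polynomial under `P` (where the rescaled mass is
  -- eventually below `K + 1`), for the same under `ν`, and for the convergence of the polynomial
  -- integrals.
  obtain ⟨δ, hδ, hδε⟩ : ∃ δ > 0, δ * (K + 1) + δ * K + δ ≤ ε := by
    refine ⟨ε / (2 * K + 2), by positivity, le_of_eq ?_⟩
    field_simp
    ring
  obtain ⟨p, hp⟩ := exists_polynomial_near_of_continuousOn 0 1 g hg.continuousOn δ hδ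
  obtain ⟨hpi, hpt⟩ := hS.tendsto_integral_polynomial h p
  rw [Metric.tendsto_atTop'] at hpt
  obtain ⟨N1, hN1⟩ := hpt δ hδ
  obtain ⟨N2, hN2⟩ := eventually_atTop.1 (hone.eventually (gt_mem_nhds (lt_add_one K)))
  refine ⟨max N1 N2, fun n hn => ?_⟩
  have e1 := hN1 n (lt_of_le_of_lt (le_max_left _ _) hn)
  have e2 := hN2 n ((le_max_right _ _).trans hn.le)
  have e3 : |∫ ω, g (Real.exp (-S (h / n) ω)) * (1 - Real.exp (-S (h / n) ω)) ∂P -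
      ∫ ω, p.eval (Real.exp (-S (h / n) ω)) * (1 - Real.exp (-S (h / n) ω)) ∂P| ≤
      δ * ∫ ω, (1 - Real.exp (-S (h / n) ω)) ∂P := by
    rw [← integral_sub (hS.integrable_exp_pow _ hg) (hS.integrable_exp_pow _ p.continuous),
      ← integral_const_mul, ← Real.norm_eq_abs]
    refine norm_integral_le_of_norm_le ((hwP _).const_mul δ) ?_
    filter_upwards [hP01 (h / n)] with ω hω
    rw [← sub_mul, norm_mul, Real.norm_of_nonneg (sub_nonneg.2 hω.2), norm_sub_rev]
    exact mul_le_mul_of_nonneg_right (hp _ hω).le (sub_nonneg.2 hω.2)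
  have e4 : |∫ x, g (Real.exp (-x)) * (1 - Real.exp (-x)) ∂ν -
      ∫ x, p.eval (Real.exp (-x)) * (1 - Real.exp (-x)) ∂ν| ≤ δ * ∫ x, (1 - Real.exp (-x)) ∂ν := by
    rw [← integral_sub hgint hpi, ← integral_const_mul, ← Real.norm_eq_abs]
    refine norm_integral_le_of_norm_le (hw.const_mul δ) ?_
    filter_upwards [hν01] with x hx
    rw [← sub_mul, norm_mul, Real.norm_of_nonneg (sub_nonneg.2 hx.2), norm_sub_rev]
    exact mul_le_mul_of_nonneg_right (hp _ hx).le (sub_nonneg.2 hx.2)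
  rw [Real.dist_eq] at e1 ⊢
  generalize (∫ ω, g (Real.exp (-S (h / n) ω)) * (1 - Real.exp (-S (h / n) ω)) ∂P) = A at *
  generalize (∫ ω, p.eval (Real.exp (-S (h / n) ω)) * (1 - Real.exp (-S (h / n) ω)) ∂P) = B at *
  generalize (∫ x, g (Real.exp (-x)) * (1 - Real.exp (-x)) ∂ν) = C at *
  generalize (∫ x, p.eval (Real.exp (-x)) * (1 - Real.exp (-x)) ∂ν) = D at *
  have f1 : |(n : ℝ) * A - n * B| ≤ δ * (K + 1) := by
    rw [← mul_sub, abs_mul, abs_of_nonneg (Nat.cast_nonneg n)]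
    calc (n : ℝ) * |A - B| ≤ n * (δ * _) := mul_le_mul_of_nonneg_left e3 (Nat.cast_nonneg n)
      _ = δ * (n * ∫ ω, (1 - Real.exp (-S (h / n) ω)) ∂P) := by ring
      _ ≤ _ := by gcongr
  have f2 : |(h : ℝ) * D - h * C| ≤ δ * K := by
    rw [← mul_sub, abs_mul, abs_of_nonneg h.coe_nonneg, abs_sub_comm]
    calc (h : ℝ) * |C - D| ≤ h * (δ * _) := mul_le_mul_of_nonneg_left e4 h.2
      _ = δ * K := by rw [hK]; ring
  calc |(n : ℝ) * A - h * C| = |(n * A - n * B) + (n * B - h * D) + (h * D - h * C)| := by ring_nf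
    _ ≤ |(n : ℝ) * A - n * B| + |(n : ℝ) * B - h * D| + |(h : ℝ) * D - h * C| := abs_add_three _ _ _
    _ < ε := by linarith

/-- A continuous ramp between `y` and `y'` stands in for the indicator of a half-line, to which the
convergence does not apply directly. -/
lemma IsSubordinator.exists_cutoff (hS : IsSubordinator S ν P) (h : ℝ≥0) {y y' : ℝ} (hy : 0 < y)
    (hyy' : y < y') : ∃ φ : ℝ → ℝ, Measurable φ ∧ (∀ x, 0 ≤ φ x ∧ φ x ≤ 1) ∧ (∀ x < y, φ x = 0) ∧
      (∀ x, y' ≤ x → φ x = 1) ∧ Integrable φ ν ∧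
      Tendsto (fun n : ℕ => (n : ℝ) * ∫ ω, φ (S (h / n) ω) ∂P) atTop (𝓝 (h * ∫ x, φ x ∂ν)) := by
  set c := Real.exp (-y') with hc
  set d := Real.exp (-y) with hd
  have hcd : c < d := Real.exp_lt_exp.2 (by linarith)
  have hd1 : d < 1 := by rw [hd, Real.exp_lt_one_iff]; linarith
  let η : ℝ → ℝ := fun z => max 0 (min 1 ((d - z) / (d - c)))
  have hηc : Continuous η := by fun_prop
  -- The maximum keeps `g` continuous at `z = 1`; where `η` is nonzero, `z < d` and the denominator
  -- is just `1 - z`.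
  let g : ℝ → ℝ := fun z => η z / max (1 - z) (1 - d)
  have hgc : Continuous g := by
    refine hηc.div (by fun_prop) fun z => ?_
    have : 0 < max (1 - z) (1 - d) := lt_max_of_lt_right (by linarith)
    exact this.ne'
  have hη0 : ∀ z, d ≤ z → η z = 0 := fun z hz => by
    refine max_eq_left ((min_le_right _ _).trans ?_)
    exact div_nonpos_of_nonpos_of_nonneg (by linarith) (by linarith)
  have hgη : ∀ z, g z * (1 - z) = η z := fun z => by
    rcases le_or_gt d z with hz | hz
    · simp [g, hη0 z hz]
    · simp only [g]
      rw [max_eq_left (by linarith), div_mul_cancel₀ _ (by linarith)]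
  obtain ⟨h1, h2⟩ := hS.tendsto_integral_continuous h hgc
  simp only [hgη] at h1 h2
  refine ⟨fun x => η (Real.exp (-x)), by fun_prop, fun x => ⟨le_max_left _ _,
    max_le zero_le_one (min_le_left _ _)⟩, fun x hx => hη0 _ (Real.exp_le_exp.2 (by linarith)),
    fun x hx => ?_, h1, h2⟩
  have : 1 ≤ (d - Real.exp (-x)) / (d - c) := by
    rw [one_le_div (by linarith)]
    have : Real.exp (-x) ≤ c := Real.exp_le_exp.2 (by linarith)
    linarith
  simp only [η]
  rw [min_eq_left this, max_eq_right zero_le_one]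

variable (P) in
/-- The probability that `S t` is at least `y`. -/
def tailProb (S : ℝ≥0 → Ω → ℝ) (t : ℝ≥0) (y : ℝ) : ℝ := P.real {ω | y ≤ S t ω}

/-- The gap between `y` and `y'` allows for an atom of `ν` at the threshold; it is absorbed later by
regular variation. -/
lemma IsSubordinator.eventually_le_nat_mul_tailProb (hS : IsSubordinator S ν P) (h : ℝ≥0)
    {y y' : ℝ} (hy : 0 < y) (hyy' : y < y') {ε : ℝ} (hε : 0 < ε) :
    ∀ᶠ n : ℕ in atTop, h * ν.real (Ici y') - ε ≤ n * tailProb P S (h / n) y := by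
  obtain ⟨φ, hm, hb, h0, h1, hi, ht⟩ := hS.exists_cutoff h hy hyy'
  have hν : ν.real (Ici y') ≤ ∫ x, φ x ∂ν := by
    rw [← integral_indicator_one measurableSet_Ici]
    refine integral_mono_ae ?_ hi (ae_of_all _ fun x => ?_)
    · exact (integrable_indicator_iff measurableSet_Ici).2
        (integrableOn_const (hS.levyMeasure.measure_Ici_lt_top (hy.trans hyy')).ne)
    · by_cases hx : x ∈ Ici y'
      · simp [hx, h1 x hx]
      · simp [hx, (hb x).1]
  have hlim : h * ν.real (Ici y') - ε < h * ∫ x, φ x ∂ν := by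
    have := mul_le_mul_of_nonneg_left hν h.coe_nonneg
    linarith
  filter_upwards [ht.eventually (lt_mem_nhds hlim)] with n hn
  refine hn.le.trans (mul_le_mul_of_nonneg_left ?_ (Nat.cast_nonneg n))
  have hmS := hS.measurable (h / n)
  have hset : MeasurableSet {ω | y ≤ S (h / n) ω} := measurableSet_le measurable_const hmS
  rw [tailProb, ← integral_indicator_one hset]
  refine integral_mono_ae ?_ ((integrable_indicator_iff hset).2 integrableOn_const)
    (ae_of_all _ fun ω => ?_)
  · exact Integrable.of_bound (C := 1) (hm.comp hmS).aestronglyMeasurable (ae_of_all _ fun ω => by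
      rw [Real.norm_of_nonneg (hb _).1]; exact (hb _).2)
  · by_cases hx : y ≤ S (h / n) ω
    · simpa [indicator, hx] using (hb _).2
    · simp [indicator, hx, h0 _ (not_le.1 hx)]

lemma IsSubordinator.eventually_nat_mul_tailProb_le (hS : IsSubordinator S ν P) (h : ℝ≥0)
    {y y' : ℝ} (hy : 0 < y) (hyy' : y < y') {ε : ℝ} (hε : 0 < ε) :
    ∀ᶠ n : ℕ in atTop, n * tailProb P S (h / n) y' ≤ h * ν.real (Ici y) + ε := by
  obtain ⟨φ, hm, hb, h0, h1, hi, ht⟩ := hS.exists_cutoff h hy hyy'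
  have hν : ∫ x, φ x ∂ν ≤ ν.real (Ici y) := by
    rw [← integral_indicator_one measurableSet_Ici]
    refine integral_mono_ae hi ?_ (ae_of_all _ fun x => ?_)
    · exact (integrable_indicator_iff measurableSet_Ici).2
        (integrableOn_const (hS.levyMeasure.measure_Ici_lt_top hy).ne)
    · by_cases hx : x ∈ Ici y
      · simp [hx, (hb x).2]
      · simp [hx, h0 x (not_le.1 hx)]
  have hlim : h * ∫ x, φ x ∂ν < h * ν.real (Ici y) + ε := by
    have := mul_le_mul_of_nonneg_left hν h.coe_nonneg
    linarith
  filter_upwards [ht.eventually (gt_mem_nhds hlim)] with n hn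
  refine le_trans (mul_le_mul_of_nonneg_left ?_ (Nat.cast_nonneg n)) hn.le
  have hmS := hS.measurable (h / n)
  have hset : MeasurableSet {ω | y' ≤ S (h / n) ω} := measurableSet_le measurable_const hmS
  rw [tailProb, ← integral_indicator_one hset]
  refine integral_mono_ae ((integrable_indicator_iff hset).2 integrableOn_const) ?_
    (ae_of_all _ fun ω => ?_)
  · exact Integrable.of_bound (C := 1) (hm.comp hmS).aestronglyMeasurable (ae_of_all _ fun ω => by
      rw [Real.norm_of_nonneg (hb _).1]; exact (hb _).2)
  · by_cases hx : y' ≤ S (h / n) ω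
    · simp [indicator, hx, h1 _ hx]
    · simpa [indicator, hx] using (hb _).1

end SmallTime

/-! ### Second moments of cell counts and of jump counts -/

section Moments

variable {Ω : Type*} [MeasurableSpace Ω] {P : Measure Ω} {S : ℝ≥0 → Ω → ℝ} {ν : Measure ℝ}

lemma cast_cellCount_eq_sum (f : ℝ≥0 → ℝ) (y : ℝ) (a h : ℝ≥0) (n : ℕ) :
    (cellCount f y a h n : ℝ) = ∑ i ∈ Finset.range n,
      (Ici y).indicator (1 : ℝ → ℝ) (f (gridPoint a h n (i + 1)) - f (gridPoint a h n i)) := by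
  rw [cellCount, Finset.card_filter, Nat.cast_sum]
  refine Finset.sum_congr rfl fun i _ => ?_
  simp [indicator]

lemma measurable_cellCount (hm : ∀ t, Measurable (S t)) (y : ℝ) (a h : ℝ≥0) (n : ℕ) :
    Measurable fun ω => (cellCount (fun t => S t ω) y a h n : ℝ) := by
  simp only [cast_cellCount_eq_sum]
  refine Finset.measurable_sum _ fun i _ => ?_
  exact (measurable_one.indicator measurableSet_Ici).comp ((hm _).sub (hm _))

/-- The jump count is an almost sure limit of the measurable cell counts. -/
lemma aemeasurable_jumpsIn (hm : ∀ t, Measurable (S t))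
    (hmono : ∀ᵐ ω ∂P, Monotone fun t => S t ω)
    (hr : ∀ᵐ ω ∂P, ∀ t, ContinuousWithinAt (fun u => S u ω) (Ici t) t) {y : ℝ} (hy : 0 < y)
    {a b : ℝ≥0} (hab : a ≤ b) :
    AEMeasurable (fun ω => (jumpsIn (fun t => S t ω) y a b : ℝ)) P := by
  refine aemeasurable_of_tendsto_metrizable_ae atTop
    (fun n => (measurable_cellCount hm y a (b - a) n).aemeasurable) ?_
  filter_upwards [hmono, hr] with ω h1 h2
  refine tendsto_const_nhds.congr' ?_
  filter_upwards [eventually_cellCount_eq h1 h2 hy a (b - a)] with n hn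
  rw [hn, add_tsub_cancel_of_le hab]

lemma IsSubordinator.integral_exceedance (hS : IsSubordinator S ν P) (y : ℝ) (r h : ℝ≥0) :
    ∫ ω, (Ici y).indicator (1 : ℝ → ℝ) (S (r + h) ω - S r ω) ∂P = tailProb P S h y := by
  have hset : MeasurableSet {ω | y ≤ S (r + h) ω - S r ω} :=
    measurableSet_le measurable_const ((hS.measurable _).sub (hS.measurable _))
  have h1 : (fun ω => (Ici y).indicator (1 : ℝ → ℝ) (S (r + h) ω - S r ω)) =
      {ω | y ≤ S (r + h) ω - S r ω}.indicator 1 := by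
    funext ω
    simp [indicator]
  rw [h1, integral_indicator_one hset, tailProb, measureReal_def, measureReal_def]
  congr 1
  exact (hS.stationary_increments r h).measure_mem_eq measurableSet_Ici

variable [IsProbabilityMeasure P]

lemma IsSubordinator.lintegral_exp (hS : IsSubordinator S ν P) (t : ℝ≥0) {β : ℝ} (hβ : 0 ≤ β) :
    ∫⁻ ω, ENNReal.ofReal (Real.exp (-β * S t ω)) ∂P =
      ENNReal.ofReal (Real.exp (-(t : ℝ) * laplaceExponent ν β)) := by
  have hm := hS.measurable t
  rw [← hS.laplace t β hβ, ofReal_integral_eq_lintegral_ofReal]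
  · refine Integrable.of_bound (C := 1) (by fun_prop) ?_
    filter_upwards [hS.ae_nonneg] with ω hω
    rw [Real.norm_of_nonneg (Real.exp_pos _).le]
    exact Real.exp_le_one_iff.2 (by nlinarith [hω t])
  · exact ae_of_all _ fun ω => (Real.exp_pos _).le

lemma abs_indicator_Ici_one_le (y x : ℝ) : |(Ici y).indicator (1 : ℝ → ℝ) x| ≤ 1 := by
  by_cases h : y ≤ x <;> simp [indicator, h]

/-- The sequence `0, a, ...` of partition points of `[a, a + h]` preceded by `0`. -/
def gridFromZero (a h : ℝ≥0) (n : ℕ) : ℕ → ℝ≥0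
  | 0 => 0
  | i + 1 => gridPoint a h n i

lemma gridFromZero_mono (a h : ℝ≥0) (n : ℕ) : Monotone (gridFromZero a h n) := by
  refine monotone_nat_of_le_succ fun i => ?_
  cases i with
  | zero => exact zero_le
  | succ i => exact gridPoint_mono a h n (Nat.le_succ i)

/-- The count is a sum of `n` independent indicators with success probability `p`. An indicator is
its own square, so its variance is at most `p`. -/
lemma IsSubordinator.integral_cellCount_sub_sq_le (hS : IsSubordinator S ν P) (y : ℝ)
    (a h : ℝ≥0) (n : ℕ) :
    ∫ ω, ((cellCount (fun t => S t ω) y a h n : ℝ) - n * tailProb P S (h / n) y) ^ 2 ∂P ≤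
      n * tailProb P S (h / n) y := by
  set p := tailProb P S (h / n) y
  let B : ℕ → Ω → ℝ := fun i ω => (Ici y).indicator (1 : ℝ → ℝ)
    (S (gridPoint a h n (i + 1)) ω - S (gridPoint a h n i) ω)
  have hind1 : Measurable ((Ici y).indicator (1 : ℝ → ℝ)) :=
    measurable_one.indicator measurableSet_Ici
  have hBm : ∀ i, Measurable (B i) := fun i =>
    hind1.comp ((hS.measurable _).sub (hS.measurable _))
  have hBL : ∀ i, MemLp (B i) 2 P := fun i =>
    MemLp.of_bound (hBm i).aestronglyMeasurable 1
      (ae_of_all _ fun ω => abs_indicator_Ici_one_le _ _)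
  have hBE : ∀ i, ∫ ω, B i ω ∂P = p := fun i => by
    simp only [B, gridPoint_succ]
    exact hS.integral_exceedance y _ _
  have hBV : ∀ i, variance (B i) P ≤ p := fun i => by
    refine (variance_le_expectation_sq (hBm i).aestronglyMeasurable).trans_eq ?_
    rw [← hBE i]
    congr 1
    funext ω
    by_cases hω : y ≤ S (gridPoint a h n (i + 1)) ω - S (gridPoint a h n i) ω <;>
      simp [B, indicator, hω]
  have hBI : iIndepFun B P :=
    (hS.indep_increments.nat (gridPoint_mono a h n)).comp
      (fun _ => (Ici y).indicator (1 : ℝ → ℝ)) (fun _ => hind1)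
  have hsum : ∫ ω, (∑ i ∈ Finset.range n, B i) ω ∂P = n * p := by
    simp only [Finset.sum_apply]
    rw [integral_finsetSum _ fun i _ => (hBL i).integrable one_le_two]
    simp [hBE]
  have hvar := IndepFun.variance_sum (s := Finset.range n) (fun i _ => hBL i)
    (fun i _ j _ hij => hBI.indepFun hij)
  have h1 : variance (∑ i ∈ Finset.range n, B i) P ≤ n * p := by
    rw [hvar]
    refine (Finset.sum_le_sum fun i _ => hBV i).trans_eq ?_
    simp
  rw [variance_eq_integral (Finset.aemeasurable_sum _ fun i _ => (hBm i).aemeasurable), hsum] at h1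
  refine le_of_eq_of_le ?_ h1
  congr 1
  funext ω
  rw [cast_cellCount_eq_sum, Finset.sum_apply]

/-- The weight depends on the increment over [0, a], the count on those after `a`; by independence
the expectation factors. -/
lemma IsSubordinator.lintegral_cellCount_sub_sq_le (hS : IsSubordinator S ν P) (y : ℝ)
    (a h : ℝ≥0) (n : ℕ) {β : ℝ} (hβ : 0 ≤ β) :
    ∫⁻ ω, ENNReal.ofReal (Real.exp (-β * S a ω)) * ENNReal.ofReal
      (((cellCount (fun t => S t ω) y a h n : ℝ) - n * tailProb P S (h / n) y) ^ 2) ∂P ≤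
      ENNReal.ofReal (Real.exp (-(a : ℝ) * laplaceExponent ν β)) *
        ENNReal.ofReal (n * tailProb P S (h / n) y) := by
  have hle := hS.integral_cellCount_sub_sq_le y a h n
  set p := tailProb P S (h / n) y
  have hcm := measurable_cellCount hS.measurable y a h n
  set Y : ℕ → Ω → ℝ := fun i ω =>
    S (gridFromZero a h n (i + 1)) ω - S (gridFromZero a h n i) ω with hY
  have hYm : ∀ i, Measurable (Y i) := fun i => (hS.measurable _).sub (hS.measurable _)
  have hYI : iIndepFun Y P := hS.indep_increments.nat (gridFromZero_mono a h n)
  have hind1 : Measurable ((Ici y).indicator (1 : ℝ → ℝ)) :=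
    measurable_one.indicator measurableSet_Ici
  let T := (Finset.range n).image Nat.succ
  -- Index 0 carries S_a - S_0, the indices in `T` carry the cells of (a, a + h].
  have hdisj : Disjoint ({0} : Finset ℕ) T := by simp [T]
  have hI := hYI.indepFun_finset {0} T hdisj hYm
  let φ : (({0} : Finset ℕ) → ℝ) → ℝ≥0∞ := fun v =>
    ENNReal.ofReal (Real.exp (-β * v ⟨0, Finset.mem_singleton_self 0⟩))
  let ψ : (T → ℝ) → ℝ≥0∞ := fun v =>
    ENNReal.ofReal (((∑ i : T, (Ici y).indicator (1 : ℝ → ℝ) (v i)) - n * p) ^ 2)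
  have hφ : Measurable φ := by fun_prop
  have hψ : Measurable ψ := by fun_prop
  have hI2 := hI.comp hφ hψ
  have hψY : (ψ ∘ fun ω (i : T) => Y i ω) = fun ω => ENNReal.ofReal
      (((cellCount (fun t => S t ω) y a h n : ℝ) - n * p) ^ 2) := by
    funext ω
    simp only [ψ, Function.comp_apply, cast_cellCount_eq_sum]
    rw [Finset.sum_coe_sort T (fun i => (Ici y).indicator (1 : ℝ → ℝ) (Y i ω)),
      Finset.sum_image (fun i _ j _ hij => Nat.succ_injective hij)]
    rfl
  have hmul := lintegral_mul_eq_lintegral_mul_lintegral_of_indepFun''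
    (hφ.comp (measurable_pi_lambda _ fun i => hYm i)).aemeasurable
    (hψ.comp (measurable_pi_lambda _ fun i => hYm i)).aemeasurable hI2
  rw [hψY] at hmul
  have hφY : (φ ∘ fun ω (i : ({0} : Finset ℕ)) => Y i ω) =ᵐ[P] fun ω =>
      ENNReal.ofReal (Real.exp (-β * S a ω)) := by
    filter_upwards [hS.start_zero] with ω hω
    simp [φ, hY, gridFromZero, hω]
  calc _ = ∫⁻ ω, ((φ ∘ fun ω (i : ({0} : Finset ℕ)) => Y i ω) * fun ω => ENNReal.ofReal
      (((cellCount (fun t => S t ω) y a h n : ℝ) - n * p) ^ 2)) ω ∂P := by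
        refine lintegral_congr_ae ?_
        filter_upwards [hφY] with ω hω
        rw [Pi.mul_apply, hω]
    _ = _ := hmul
    _ ≤ _ := by
      rw [lintegral_congr_ae hφY, hS.lintegral_exp a hβ]
      refine mul_le_mul_right ?_ _
      have hint : Integrable (fun ω =>
          ((cellCount (fun t => S t ω) y a h n : ℝ) - n * p) ^ 2) P := by
        refine Integrable.of_bound (C := (n + |n * p|) ^ 2)
          ((hcm.sub_const _).pow_const 2).aestronglyMeasurable (ae_of_all _ fun ω => ?_)
        rw [norm_pow, Real.norm_eq_abs]
        gcongr
        refine (abs_sub _ _).trans ?_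
        gcongr
        rw [abs_of_nonneg (Nat.cast_nonneg _)]
        exact_mod_cast (Finset.card_filter_le _ _).trans_eq (Finset.card_range n)
      rw [← ofReal_integral_eq_lintegral_ofReal hint (ae_of_all _ fun ω => sq_nonneg _)]
      exact ENNReal.ofReal_le_ofReal hle

/-- The number of jumps of size at least `y` in `(a, a + h]` is concentrated, also under the weight
`exp (-β S_a)`, around a constant close to `h * ν [y, ∞)`. -/
lemma IsSubordinator.exists_lintegral_jumpsIn_sub_sq_le (hS : IsSubordinator S ν P) (a h : ℝ≥0)
    {y : ℝ} (hy : 0 < y) : ∃ m : ℝ, (∀ y', y < y' → h * ν.real (Ici y') ≤ m) ∧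
      (∀ y', 0 < y' → y' < y → m ≤ h * ν.real (Ici y')) ∧
      ∀ β, 0 ≤ β → ∫⁻ ω, ENNReal.ofReal (Real.exp (-β * S a ω)) * ENNReal.ofReal
        (((jumpsIn (fun t => S t ω) y a (a + h) : ℝ) - m) ^ 2) ∂P ≤
        ENNReal.ofReal (Real.exp (-(a : ℝ) * laplaceExponent ν β)) * ENNReal.ofReal m := by
  set M : ℕ → ℝ := fun n => n * tailProb P S (h / n) y with hM
  have hbdd : ∀ᶠ n in atTop, M n ∈ Icc 0 (h * ν.real (Ici (y / 2)) + 1) := by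
    filter_upwards [hS.eventually_nat_mul_tailProb_le h (half_pos hy) (half_lt_self hy) one_pos]
      with n hn
    exact ⟨mul_nonneg (Nat.cast_nonneg _) measureReal_nonneg, hn⟩
  -- The tail estimates alone do not give convergence of `M` if `ν` has an atom at `y`; boundedness
  -- gives a subsequential limit, which is enough.
  obtain ⟨m, -, k, hk, hkm⟩ := isCompact_Icc.tendsto_subseq' hbdd.frequently
  refine ⟨m, fun y' hy' => ?_, fun y' hy' hyy' => ?_, fun β hβ => ?_⟩
  · refine le_of_forall_pos_sub_le fun ε hε => ?_
    exact ge_of_tendsto hkm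
      (hk.tendsto_atTop.eventually (hS.eventually_le_nat_mul_tailProb h hy hy' hε))
  · refine le_of_forall_pos_le_add fun ε hε => ?_
    exact le_of_tendsto hkm
      (hk.tendsto_atTop.eventually (hS.eventually_nat_mul_tailProb_le h hy' hyy' hε))
  · have hlim : ∀ᵐ ω ∂P, Tendsto (fun j => ENNReal.ofReal (Real.exp (-β * S a ω)) * ENNReal.ofReal
        (((cellCount (fun t => S t ω) y a h (k j) : ℝ) - M (k j)) ^ 2)) atTop
        (𝓝 (ENNReal.ofReal (Real.exp (-β * S a ω)) * ENNReal.ofReal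
        (((jumpsIn (fun t => S t ω) y a (a + h) : ℝ) - m) ^ 2))) := by
      filter_upwards [hS.monotone, hS.right_continuous] with ω h1 h2
      refine ENNReal.Tendsto.const_mul (ENNReal.tendsto_ofReal ?_) (Or.inr ENNReal.ofReal_ne_top)
      refine (Tendsto.sub ?_ hkm).pow 2
      refine tendsto_const_nhds.congr' ?_
      filter_upwards [hk.tendsto_atTop.eventually (eventually_cellCount_eq h1 h2 hy a h)] with j hj
      rw [hj]
    have hSm := hS.measurable a
    have hcm := measurable_cellCount hS.measurable y a h
    calc _ = ∫⁻ ω, liminf (fun j => ENNReal.ofReal (Real.exp (-β * S a ω)) * ENNReal.ofReal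
        (((cellCount (fun t => S t ω) y a h (k j) : ℝ) - M (k j)) ^ 2)) atTop ∂P := by
          refine lintegral_congr_ae ?_
          filter_upwards [hlim] with ω hω
          exact hω.liminf_eq.symm
      -- Fatou's lemma transfers the bound from cells to jumps.
      _ ≤ liminf (fun j => ∫⁻ ω, ENNReal.ofReal (Real.exp (-β * S a ω)) * ENNReal.ofReal
        (((cellCount (fun t => S t ω) y a h (k j) : ℝ) - M (k j)) ^ 2) ∂P) atTop :=
          lintegral_liminf_le fun j => by have := hcm (k j); fun_prop
      _ ≤ liminf (fun j => ENNReal.ofReal (Real.exp (-(a : ℝ) * laplaceExponent ν β)) *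
          ENNReal.ofReal (M (k j))) atTop :=
          liminf_le_liminf (Eventually.of_forall fun j =>
            hS.lintegral_cellCount_sub_sq_le y a h (k j) hβ)
      _ = _ := (ENNReal.Tendsto.const_mul (ENNReal.tendsto_ofReal hkm)
          (Or.inr ENNReal.ofReal_ne_top)).liminf_eq

end Moments

/-! ### Regular variation along geometric sequences -/

/-- A nonnegative nonincreasing function on `(0, ∞)` that is regularly varying at `0` with index
`-α`, `α > 0`. -/
structure IsRegVarying (G : ℝ → ℝ) (α : ℝ) : Prop where
  index_pos : 0 < α
  nonneg : ∀ y, 0 ≤ G y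
  anti : ∀ y y', 0 < y → y ≤ y' → G y' ≤ G y
  eventually_pos : ∀ᶠ y in 𝓝[>] 0, 0 < G y
  tendsto_ratio : ∀ c, 0 < c → Tendsto (fun y => G (c * y) / G y) (𝓝[>] 0) (𝓝 (c ^ (-α)))

lemma tendsto_one_div_nhdsGT_zero : Tendsto (fun y : ℝ => 1 / y) (𝓝[>] 0) atTop := by
  simpa using tendsto_inv_nhdsGT_zero (𝕜 := ℝ)

lemma tendsto_const_mul_nhdsGT_zero {c : ℝ} (hc : 0 < c) :
    Tendsto (fun y => c * y) (𝓝[>] 0) (𝓝[>] 0) := by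
  refine tendsto_nhdsWithin_iff.2 ⟨?_, ?_⟩
  · have : Tendsto (fun y => c * y) (𝓝 0) (𝓝 (c * 0)) := (continuous_const_mul c).tendsto 0
    rw [mul_zero] at this
    exact this.mono_left nhdsWithin_le_nhds
  · filter_upwards [self_mem_nhdsWithin] with y hy using mul_pos hc hy

lemma HasRegVaryingTail.eventually_scaling_eq {ν : Measure ℝ} {α : ℝ} {ℓ : ℝ → ℝ}
    (h : HasRegVaryingTail ν α ℓ) : ∀ᶠ y in 𝓝[>] 0, scaling α ℓ y = ν.real (Ici y) := by
  filter_upwards [h.tail_eq] with y hy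
  rw [hy, scaling, mul_comm]

lemma HasRegVaryingTail.isRegVarying {ν : Measure ℝ} {α : ℝ} {ℓ : ℝ → ℝ}
    (h : HasRegVaryingTail ν α ℓ) (hν : IsLevyMeasure ν) :
    IsRegVarying (fun y => ν.real (Ici y)) α where
  index_pos := h.index_pos
  nonneg _ := measureReal_nonneg
  anti y y' hy hyy' := measureReal_mono (Ici_subset_Ici.2 hyy') (hν.measure_Ici_lt_top hy).ne
  eventually_pos := by
    obtain ⟨X, hX, -⟩ := h.slowlyVarying.pos_measurable
    filter_upwards [h.tail_eq, tendsto_one_div_nhdsGT_zero.eventually_ge_atTop X,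
      self_mem_nhdsWithin] with y h1 h2 h3
    rw [h1]
    exact mul_pos (hX _ h2) (Real.rpow_pos_of_pos h3 _)
  tendsto_ratio c hc := by
    have h1 := (h.slowlyVarying.tendsto_ratio c⁻¹ (inv_pos.2 hc)).comp tendsto_one_div_nhdsGT_zero
    have h2 := h1.mul_const (c ^ (-α))
    rw [one_mul] at h2
    refine h2.congr' ?_
    filter_upwards [h.tail_eq, (tendsto_const_mul_nhdsGT_zero hc).eventually h.tail_eq,
      self_mem_nhdsWithin] with y h3 h4 h5
    have h5' : 0 < y := h5
    rw [h3, h4, Real.mul_rpow hc.le h5'.le, Function.comp_apply]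
    have h6 : (0 : ℝ) < y ^ (-α) := Real.rpow_pos_of_pos h5' _
    rw [show c⁻¹ * (1 / y) = 1 / (c * y) by field_simp, ← mul_assoc, mul_div_mul_right _ _ h6.ne']
    ring

section Geometric

variable {G : ℝ → ℝ} {α : ℝ}

lemma tendsto_geometric_nhdsGT {r : ℝ} (hr0 : 0 < r) (hr1 : r < 1) :
    Tendsto (fun n : ℕ => r ^ n) atTop (𝓝[>] 0) :=
  tendsto_nhdsWithin_iff.2 ⟨tendsto_pow_atTop_nhds_zero_of_lt_one hr0.le hr1,
    Eventually.of_forall fun n => pow_pos hr0 n⟩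

lemma eventually_nhdsGT_of_geometric {r : ℝ} (hr0 : 0 < r) (hr1 : r < 1) {Q : ℝ → Prop}
    (h : ∀ᶠ n : ℕ in atTop, ∀ y, r ^ (n + 1) < y → y ≤ r ^ n → Q y) : ∀ᶠ y in 𝓝[>] 0, Q y := by
  obtain ⟨n₀, hn₀⟩ := eventually_atTop.1 h
  filter_upwards [Ioo_mem_nhdsGT (pow_pos hr0 n₀)] with y hy
  obtain ⟨n, hn1, hn2⟩ := exists_nat_pow_near_of_lt_one hy.1
    (hy.2.le.trans (pow_le_one₀ hr0.le hr1.le)) hr0 hr1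
  refine hn₀ n ?_ y hn1 hn2
  have := (pow_lt_pow_iff_right_of_lt_one₀ hr0 hr1).1 (hn1.trans hy.2)
  omega

lemma IsRegVarying.tendsto_ratio_geometric (hG : IsRegVarying G α) {r : ℝ}
    (hr0 : 0 < r) (hr1 : r < 1) :
    Tendsto (fun n : ℕ => G (r ^ (n + 1)) / G (r ^ n)) atTop (𝓝 (r ^ (-α))) := by
  refine ((hG.tendsto_ratio r hr0).comp (tendsto_geometric_nhdsGT hr0 hr1)).congr fun n => ?_
  simp only [Function.comp_apply, pow_succ']

/-- Ratio test: consecutive terms have ratio tending to r^(-α) r^(2α) = r^α < 1. -/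
lemma IsRegVarying.summable_geometric (hG : IsRegVarying G α) {r : ℝ}
    (hr0 : 0 < r) (hr1 : r < 1) :
    Summable fun n : ℕ => G (r ^ (n + 1)) / G (r ^ n) ^ 2 := by
  have hpos := (tendsto_geometric_nhdsGT hr0 hr1).eventually hG.eventually_pos
  have hpos1 := (tendsto_add_atTop_nat 1).eventually hpos
  have hpos2 := (tendsto_add_atTop_nat 2).eventually hpos
  have hρ := hG.tendsto_ratio_geometric hr0 hr1
  have hρ1 := hρ.comp (tendsto_add_atTop_nat 1)
  have hrα : (0 : ℝ) < r ^ (-α) := Real.rpow_pos_of_pos hr0 _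
  have hlim := hρ1.mul ((hρ.pow 2).inv₀ (by positivity))
  have hl : r ^ (-α) * ((r ^ (-α)) ^ 2)⁻¹ < 1 := by
    rw [sq, mul_inv, mul_inv_cancel_left₀ hrα.ne']
    refine inv_lt_one_of_one_lt₀ ?_
    exact Real.one_lt_rpow_of_pos_of_lt_one_of_neg hr0 hr1 (by linarith [hG.index_pos])
  refine summable_of_ratio_test_tendsto_lt_one hl ?_ (hlim.congr' ?_)
  · filter_upwards [hpos, hpos1] with n h0 h1
    positivity
  · filter_upwards [hpos, hpos1, hpos2] with n h0 h1 h2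
    rw [Real.norm_of_nonneg (by positivity), Real.norm_of_nonneg (by positivity)]
    simp only [Function.comp_apply]
    field_simp

/-- A Potter type bound. -/
lemma IsRegVarying.exists_potter (hG : IsRegVarying G α) :
    ∃ y₁ > 0, ∀ y₀, 0 < y₀ → y₀ ≤ y₁ → y₀ ≤ 1 → ∃ C > 0,
    ∀ x z, 0 < x → x ≤ y₀ → x ≤ z → z ≤ 1 → G (min z y₀) ≤ C * (z / x) ^ (-(α / 2)) * G x := by
  have hα := hG.index_pos
  have h2 : (2 : ℝ) ^ (-α) < 2 ^ (-(α / 2)) :=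
    Real.rpow_lt_rpow_of_exponent_lt one_lt_two (by linarith)
  have hev := ((hG.tendsto_ratio 2 two_pos).eventually (gt_mem_nhds h2)).and hG.eventually_pos
  obtain ⟨y₁, hy₁, hy⟩ := mem_nhdsGT_iff_exists_Ioo_subset.1 hev
  have hdouble : ∀ y, 0 < y → y < y₁ → G (2 * y) ≤ 2 ^ (-(α / 2)) * G y := fun y h0 h1 => by
    obtain ⟨h3, h4⟩ := hy ⟨h0, h1⟩
    rw [div_lt_iff₀ h4] at h3
    exact h3.le
  -- The factor `2 ^ (α / 2)` pays for rounding down to a power of 2, and `y₀ ^ (-(α / 2))` for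
  -- capping at `y₀`, since `min z y₀ ≥ y₀ * z` when both are at most 1.
  refine ⟨y₁, hy₁, fun y₀ hy0 hy01 hy0' => ⟨2 ^ (α / 2) * y₀ ^ (-(α / 2)), by positivity,
    fun x z hx hxy hxz hz => ?_⟩⟩
  have hiter : ∀ n : ℕ, 2 ^ n * x ≤ y₁ → G (2 ^ n * x) ≤ ((2 : ℝ) ^ n) ^ (-(α / 2)) * G x := by
    intro n
    induction n with
    | zero => simp
    | succ n ih =>
      intro hn
      rw [pow_succ', mul_assoc] at hn
      have h0 : 0 < 2 ^ n * x := by positivity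
      calc G (2 ^ (n + 1) * x) = G (2 * (2 ^ n * x)) := by rw [pow_succ', mul_assoc]
        _ ≤ 2 ^ (-(α / 2)) * G (2 ^ n * x) := hdouble _ h0 (by linarith)
        _ ≤ 2 ^ (-(α / 2)) * (((2 : ℝ) ^ n) ^ (-(α / 2)) * G x) := by
          gcongr
          exact ih (by linarith)
        _ = _ := by rw [pow_succ', Real.mul_rpow two_pos.le (by positivity), mul_assoc]
  set w := min z y₀ with hw
  have hxw : x ≤ w := le_min hxz hxy
  obtain ⟨n, hn1, hn2⟩ := exists_nat_pow_near ((one_le_div hx).2 hxw) one_lt_two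
  rw [le_div_iff₀ hx] at hn1
  have hwz : y₀ * (z / x) ≤ w / x := by
    rw [← mul_div_assoc]
    refine div_le_div_of_nonneg_right (le_min ?_ ?_) hx.le
    · nlinarith
    · nlinarith
  have hz0 : 0 < z := hx.trans_le hxz
  have hGx := hG.nonneg x
  calc G w ≤ G (2 ^ n * x) := hG.anti _ _ (by positivity) hn1
    _ ≤ ((2 : ℝ) ^ n) ^ (-(α / 2)) * G x := hiter n (hn1.trans ((min_le_right _ _).trans hy01))
    _ ≤ (2⁻¹ * (y₀ * (z / x))) ^ (-(α / 2)) * G x := by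
      refine mul_le_mul_of_nonneg_right ?_ hGx
      refine Real.rpow_le_rpow_of_nonpos (by positivity) ?_ (by linarith)
      rw [pow_succ'] at hn2
      linarith
    _ = _ := by
      rw [Real.mul_rpow (by positivity) (by positivity), Real.mul_rpow (by positivity)
        (by positivity), Real.inv_rpow two_pos.le, Real.rpow_neg two_pos.le (α / 2), inv_inv]
      ring

/-- A nonincreasing function that along `r ^ n` is close to `h * G` is eventually close to
`h * G`. -/
lemma IsRegVarying.eventually_mem_of_geometric (hG : IsRegVarying G α) {r : ℝ}
    (hr0 : 0 < r) (hr1 : r < 1) {N : ℝ → ℝ}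
    (hN0 : ∀ y, 0 ≤ N y) (hN : ∀ y y', 0 < y → y ≤ y' → N y' ≤ N y) {h : ℝ} {m : ℕ → ℝ}
    (hm1 : ∀ n y, r ^ n < y → h * G y ≤ m n) (hm2 : ∀ n y, 0 < y → y < r ^ n → m n ≤ h * G y)
    (hlim : Tendsto (fun n => (N (r ^ n) - m n) / G (r ^ n)) atTop (𝓝 0)) {l u : ℝ}
    (hl : l < h * (r ^ α * r ^ α)) (hu : h * (r ^ (-α) * r ^ (-α)) < u) :
    ∀ᶠ y in 𝓝[>] 0, l < N y / G y ∧ N y / G y < u := by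
  have hpos := (tendsto_geometric_nhdsGT hr0 hr1).eventually hG.eventually_pos
  have hpos1 := (tendsto_add_atTop_nat 1).eventually hpos
  have hpos2 := (tendsto_add_atTop_nat 2).eventually hpos
  have hρ := hG.tendsto_ratio_geometric hr0 hr1
  have hρ1 := hρ.comp (tendsto_add_atTop_nat 1)
  have hlim1 := hlim.comp (tendsto_add_atTop_nat 1)
  have hrα : (0 : ℝ) < r ^ (-α) := Real.rpow_pos_of_pos hr0 _
  -- Two ratios are lost: one in comparing `y` with the ends of its geometric cell, one because `m
  -- (n + 1)` is controlled by `h * G` only at a neighbouring point of the sequence.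
  have hU := (hlim1.add (hρ1.const_mul h)).mul hρ
  have hV := (hlim1.add ((hρ.inv₀ hrα.ne').const_mul h)).mul (hρ1.inv₀ hrα.ne')
  rw [zero_add, mul_assoc] at hU hV
  rw [← Real.rpow_neg hr0.le, neg_neg] at hV
  have hlt : ∀ n, r ^ (n + 1) < r ^ n := fun n => by
    rw [pow_succ]; exact mul_lt_of_lt_one_right (pow_pos hr0 n) hr1
  have hup : ∀ᶠ y in 𝓝[>] 0, N y / G y < u := by
    refine eventually_nhdsGT_of_geometric hr0 hr1 ?_
    filter_upwards [hU.eventually (gt_mem_nhds hu), hpos, hpos1] with n hn h0 h1 y hy1 hy2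
    have hy : 0 < y := (pow_pos hr0 _).trans hy1
    have hGy := hG.anti _ _ hy hy2
    refine lt_of_le_of_lt ?_ hn
    simp only [Function.comp_apply]
    rw [← mul_div_assoc h, ← add_div]
    have hmm := hm2 (n + 1) (r ^ (n + 1 + 1)) (by positivity) (hlt _)
    calc N y / G y ≤ N (r ^ (n + 1)) / G (r ^ n) :=
          div_le_div₀ (hN0 _) (hN _ _ (by positivity) hy1.le) h0 hGy
      _ = N (r ^ (n + 1)) / G (r ^ (n + 1)) * (G (r ^ (n + 1)) / G (r ^ n)) := by
          rw [div_mul_div_cancel₀ h1.ne']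
      _ ≤ _ := by
          refine mul_le_mul_of_nonneg_right ?_ (by positivity)
          refine div_le_div_of_nonneg_right ?_ h1.le
          linarith
  have hdown : ∀ᶠ y in 𝓝[>] 0, l < N y / G y := by
    refine eventually_nhdsGT_of_geometric hr0 hr1 ?_
    have key : ∀ᶠ n in atTop, ∀ y, r ^ (n + 1 + 1) < y → y ≤ r ^ (n + 1) → l < N y / G y := by
      filter_upwards [hV.eventually (lt_mem_nhds hl), hpos, hpos1, hpos2] with n hn h0 h1 h2 y hy1 hy2
      have hy : 0 < y := (pow_pos hr0 _).trans hy1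
      have hGy : G y ≤ G (r ^ (n + 1 + 1)) := hG.anti _ _ (by positivity) hy1.le
      refine lt_of_lt_of_le hn ?_
      simp only [Function.comp_apply]
      rw [inv_div, inv_div, ← mul_div_assoc h, ← add_div]
      have hmm := hm1 (n + 1) (r ^ n) (hlt n)
      have hGy0 : 0 < G y := h1.trans_le (hG.anti _ _ hy hy2)
      calc _ ≤ N (r ^ (n + 1)) / G (r ^ (n + 1)) * (G (r ^ (n + 1)) / G (r ^ (n + 1 + 1))) := by
            refine mul_le_mul_of_nonneg_right ?_ (by positivity)
            refine div_le_div_of_nonneg_right ?_ h1.le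
            linarith
        _ = N (r ^ (n + 1)) / G (r ^ (n + 1 + 1)) := by rw [div_mul_div_cancel₀ h1.ne']
        _ ≤ _ := div_le_div₀ (hN0 _) (hN _ _ hy hy2) hGy0 hGy
    obtain ⟨n₀, hn₀⟩ := eventually_atTop.1 key
    filter_upwards [eventually_ge_atTop (n₀ + 1)] with n hn
    obtain ⟨k, rfl⟩ := Nat.exists_eq_add_of_le' hn
    exact hn₀ (k + n₀) (Nat.le_add_left _ _)
  filter_upwards [hup, hdown] with y h1 h2 using ⟨h2, h1⟩

/-- Uniform control of a nonincreasing function by its values along `2⁻ⁿ`. -/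
lemma IsRegVarying.exists_le_mul_of_geometric (hG : IsRegVarying G α) {h : ℝ}
    (hh : 0 ≤ h) : ∃ C > 0, ∃ y₂ > 0, ∀ N : ℝ → ℝ,
    (∀ y y', 0 < y → y ≤ y' → N y' ≤ N y) → ∀ m : ℕ → ℝ,
    (∀ n y, 0 < y → y < (1 / 2) ^ n → m n ≤ h * G y) → ∀ Z : ℝ,
    (∀ n, (N ((1 / 2) ^ n) - m n) ^ 2 / G ((1 / 2) ^ n) ^ 2 ≤ Z) →
    ∀ y, 0 < y → y ≤ y₂ → N y ≤ C * (1 + Z) * G y := by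
  have hr0 : (0 : ℝ) < 1 / 2 := by norm_num
  have hr1 : (1 / 2 : ℝ) < 1 := by norm_num
  have hpos := (tendsto_geometric_nhdsGT hr0 hr1).eventually hG.eventually_pos
  have hρ := hG.tendsto_ratio_geometric hr0 hr1
  set K := (1 / 2 : ℝ) ^ (-α) + 1 with hK
  have hK0 : 0 < K := by positivity
  obtain ⟨n₀, hn₀⟩ := eventually_atTop.1 (hpos.and (hρ.eventually (gt_mem_nhds (lt_add_one _))))
  refine ⟨(1 + h * K) * K, by positivity, (1 / 2) ^ n₀, by positivity,
    fun N hN m hm Z hZ y hy hy2 => ?_⟩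
  obtain ⟨n, hn1, hn2⟩ := exists_nat_pow_near_of_lt_one hy
    (hy2.trans (pow_le_one₀ hr0.le hr1.le)) hr0 hr1
  have hn : n₀ ≤ n := by
    have := (pow_lt_pow_iff_right_of_lt_one₀ hr0 hr1).1 (hn1.trans_le hy2)
    omega
  obtain ⟨g0, k0⟩ := hn₀ n hn
  obtain ⟨g1, k1⟩ := hn₀ (n + 1) (by omega)
  rw [← hK, div_lt_iff₀ g0] at k0
  rw [← hK, div_lt_iff₀ g1] at k1
  have h1 := hm (n + 1) ((1 / 2) ^ (n + 1 + 1)) (by positivity)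
    (pow_lt_pow_right_of_lt_one₀ hr0 hr1 (Nat.lt_succ_self _))
  have h2 := hZ (n + 1)
  rw [← div_pow] at h2
  have hZ0 : 0 ≤ Z := (sq_nonneg _).trans h2
  -- From 2t ≤ 1 + t² and t² ≤ Z.
  have h3 : (N ((1 / 2) ^ (n + 1)) - m (n + 1)) / G ((1 / 2) ^ (n + 1)) ≤ 1 + Z := by
    nlinarith [sq_nonneg ((N ((1 / 2) ^ (n + 1)) - m (n + 1)) / G ((1 / 2) ^ (n + 1)) - 1)]
  rw [div_le_iff₀ g1] at h3
  have h4 := hG.anti _ _ hy hn2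
  calc N y ≤ N ((1 / 2) ^ (n + 1)) := hN _ _ (by positivity) hn1.le
    _ ≤ (1 + Z) * G ((1 / 2) ^ (n + 1)) + h * (K * G ((1 / 2) ^ (n + 1))) := by
      have := mul_le_mul_of_nonneg_left k1.le hh
      linarith
    _ ≤ (1 + Z) * G ((1 / 2) ^ (n + 1)) + (1 + Z) * (h * (K * G ((1 / 2) ^ (n + 1)))) := by
      have h5 : 0 ≤ h * (K * G ((1 / 2) ^ (n + 1))) := by positivity
      nlinarith
    _ = (1 + Z) * (1 + h * K) * G ((1 / 2) ^ (n + 1)) := by ring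
    _ ≤ (1 + Z) * (1 + h * K) * (K * G y) := by
      refine mul_le_mul_of_nonneg_left (k0.le.trans ?_) (by positivity)
      gcongr
    _ = _ := by ring

end Geometric

/-! ### Law of large numbers for the jumps of S, and the dominating sequence -/

section Probabilistic

variable {Ω : Type*} [MeasurableSpace Ω] {P : Measure Ω}
  {S : ℝ≥0 → Ω → ℝ} {ν : Measure ℝ} {α : ℝ}

variable (ν) in
/-- The normalized sum of the squared deviations of the numbers of jumps of size at least `r ^ n`
in `(a, a + h]` from the constants `m n`. -/
def deviation (f : ℝ≥0 → ℝ) (r : ℝ) (m : ℕ → ℝ) (a h : ℝ≥0) : ℝ≥0∞ :=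
  ∑' n : ℕ, ENNReal.ofReal (((jumpsIn f (r ^ n) a (a + h) : ℝ) - m n) ^ 2 /
    ν.real (Ici (r ^ n)) ^ 2)

lemma IsSubordinator.aemeasurable_deviation (hS : IsSubordinator S ν P) {r : ℝ} (hr0 : 0 < r)
    (m : ℕ → ℝ) (a h : ℝ≥0) :
    AEMeasurable (fun ω => deviation ν (fun t => S t ω) r m a h) P := by
  refine AEMeasurable.tsum fun n => ?_
  have := aemeasurable_jumpsIn hS.measurable hS.monotone hS.right_continuous (pow_pos hr0 n)
    (le_self_add : a ≤ a + h)
  fun_prop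

/-- The integrand is positive ν-almost everywhere, so a zero integral would force `ν = 0`, against
the eventual positivity of the tail. -/
lemma IsSubordinator.laplaceExponent_pos (hS : IsSubordinator S ν P)
    (hG : IsRegVarying (fun y => ν.real (Ici y)) α) {β : ℝ} (hβ : 0 < β) :
    0 < laplaceExponent ν β := by
  have hae : ∀ᵐ y ∂ν, 0 < 1 - Real.exp (-β * y) := by
    filter_upwards [hS.levyMeasure.ae_pos] with y hy
    rw [sub_pos, Real.exp_lt_one_iff]
    nlinarith
  refine (integral_pos_iff_support_of_nonneg_ae ?_
    (hS.levyMeasure.integrable_one_sub_exp hβ.le)).2 ?_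
  · filter_upwards [hae] with y hy using hy.le
  · rw [pos_iff_ne_zero]
    intro h0
    obtain ⟨y, hy⟩ := hG.eventually_pos.exists
    have : ν = 0 := by
      have h2 : ∀ᵐ y ∂ν, False := by
        filter_upwards [hae, measure_eq_zero_iff_ae_notMem.1 h0] with y h1 h2
        exact h2 h1.ne'
      exact ae_eq_bot.1 (eventually_false_iff_eq_bot.1 h2)
    simp [this] at hy

lemma IsSubordinator.ae_deviation_lt_top (hS : IsSubordinator S ν P) {r : ℝ} (hr0 : 0 < r)
    {a h : ℝ≥0} {m : ℕ → ℝ} {c K : ℝ}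
    (hm : ∀ β, 0 ≤ β → ∫⁻ ω, ENNReal.ofReal (Real.exp (-β * S a ω)) *
        deviation ν (fun t => S t ω) r m a h ∂P ≤
        ENNReal.ofReal (Real.exp (-c * laplaceExponent ν β)) * ENNReal.ofReal K) :
    ∀ᵐ ω ∂P, deviation ν (fun t => S t ω) r m a h < ∞ := by
  -- Taking `β = 0` removes the weight.
  have h0 := hm 0 le_rfl
  simp only [neg_zero, zero_mul, Real.exp_zero, ENNReal.ofReal_one, one_mul] at h0
  exact ae_lt_top' (hS.aemeasurable_deviation hr0 m a h)
    (lt_of_le_of_lt h0 (ENNReal.mul_lt_top ENNReal.ofReal_lt_top ENNReal.ofReal_lt_top)).ne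

variable [IsProbabilityMeasure P]

/-- The variance at level r^n is at most `m n ≤ h * ν [r^(n+1), ∞)`, which after normalization is
summable. The starting time `a` enters the bound only through the exponential factor; this gives the
geometric decay in `exists_dominating`. -/
lemma IsSubordinator.exists_lintegral_deviation_le (hS : IsSubordinator S ν P)
    (hG : IsRegVarying (fun y => ν.real (Ici y)) α) {r : ℝ} (hr0 : 0 < r) (hr1 : r < 1)
    (a h : ℝ≥0) : ∃ m : ℕ → ℝ, (∀ n y, r ^ n < y → h * ν.real (Ici y) ≤ m n) ∧
      (∀ n y, 0 < y → y < r ^ n → m n ≤ h * ν.real (Ici y)) ∧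
      ∀ β, 0 ≤ β → ∫⁻ ω, ENNReal.ofReal (Real.exp (-β * S a ω)) *
        deviation ν (fun t => S t ω) r m a h ∂P ≤
        ENNReal.ofReal (Real.exp (-(a : ℝ) * laplaceExponent ν β)) * ENNReal.ofReal
          (h * ∑' n : ℕ, ν.real (Ici (r ^ (n + 1))) / ν.real (Ici (r ^ n)) ^ 2) := by
  choose m hm1 hm2 hm3 using fun n : ℕ =>
    hS.exists_lintegral_jumpsIn_sub_sq_le a h (pow_pos hr0 n)
  refine ⟨m, hm1, hm2, fun β hβ => ?_⟩
  have hSm := hS.measurable a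
  have hNm : ∀ n : ℕ, AEMeasurable (fun ω =>
      (jumpsIn (fun t => S t ω) (r ^ n) a (a + h) : ℝ)) P := fun n =>
    aemeasurable_jumpsIn hS.measurable hS.monotone hS.right_continuous (pow_pos hr0 n) le_self_add
  simp only [deviation, ← ENNReal.tsum_mul_left]
  rw [lintegral_tsum fun n => by have := hNm n; fun_prop]
  have hterm : ∀ n : ℕ, ∫⁻ ω, ENNReal.ofReal (Real.exp (-β * S a ω)) * ENNReal.ofReal
      (((jumpsIn (fun t => S t ω) (r ^ n) a (a + h) : ℝ) - m n) ^ 2 /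
        ν.real (Ici (r ^ n)) ^ 2) ∂P ≤
      ENNReal.ofReal (Real.exp (-(a : ℝ) * laplaceExponent ν β)) * ENNReal.ofReal
        (h * (ν.real (Ici (r ^ (n + 1))) / ν.real (Ici (r ^ n)) ^ 2)) := fun n => by
    have h1 : ∀ ω, ENNReal.ofReal (Real.exp (-β * S a ω)) * ENNReal.ofReal
      (((jumpsIn (fun t => S t ω) (r ^ n) a (a + h) : ℝ) - m n) ^ 2 /
        ν.real (Ici (r ^ n)) ^ 2) = ENNReal.ofReal (Real.exp (-β * S a ω)) * ENNReal.ofReal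
      (((jumpsIn (fun t => S t ω) (r ^ n) a (a + h) : ℝ) - m n) ^ 2) *
        ENNReal.ofReal ((ν.real (Ici (r ^ n)) ^ 2)⁻¹) := fun ω => by
      rw [div_eq_mul_inv, ENNReal.ofReal_mul (sq_nonneg _), mul_assoc]
    simp only [h1]
    rw [lintegral_mul_const' _ _ ENNReal.ofReal_ne_top]
    refine (mul_le_mul_left (hm3 n β hβ) _).trans ?_
    have hmn : m n ≤ h * ν.real (Ici (r ^ (n + 1))) := hm2 n _ (by positivity)
      (pow_lt_pow_right_of_lt_one₀ hr0 hr1 (Nat.lt_succ_self n))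
    rw [mul_assoc, ← ENNReal.ofReal_mul' (by positivity)]
    refine mul_le_mul_right (ENNReal.ofReal_le_ofReal ?_) _
    rw [← mul_div_assoc, div_eq_mul_inv]
    gcongr
  refine (ENNReal.tsum_le_tsum hterm).trans ?_
  have hsum := (hG.summable_geometric hr0 hr1).mul_left (h : ℝ)
  rw [ENNReal.tsum_mul_left, ← tsum_mul_left, ENNReal.ofReal_tsum_of_nonneg _ hsum]
  intro n
  have := hG.nonneg (r ^ (n + 1))
  positivity

lemma div_sq_le_toReal_deviation {f : ℝ≥0 → ℝ} {r : ℝ} {m : ℕ → ℝ} {a h : ℝ≥0}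
    (hd : deviation ν f r m a h < ∞) (n : ℕ) :
    ((jumpsIn f (r ^ n) a (a + h) : ℝ) - m n) ^ 2 / ν.real (Ici (r ^ n)) ^ 2 ≤
      (deviation ν f r m a h).toReal := by
  rw [← ENNReal.ofReal_le_iff_le_toReal hd.ne]
  exact ENNReal.le_tsum n

lemma tendsto_of_deviation_lt_top {f : ℝ≥0 → ℝ} {r : ℝ} {m : ℕ → ℝ} {a h : ℝ≥0}
    (hd : deviation ν f r m a h < ∞) :
    Tendsto (fun n : ℕ => ((jumpsIn f (r ^ n) a (a + h) : ℝ) - m n) / ν.real (Ici (r ^ n))) atTop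
      (𝓝 0) := by
  have h1 := ENNReal.tendsto_atTop_zero_of_tsum_ne_top hd.ne
  have h2 := (ENNReal.tendsto_toReal ENNReal.zero_ne_top).comp h1
  have h3 := (Real.continuous_sqrt.tendsto _).comp h2
  rw [ENNReal.toReal_zero, Real.sqrt_zero] at h3
  rw [tendsto_zero_iff_abs_tendsto_zero]
  refine h3.congr fun n => ?_
  simp only [Function.comp_apply]
  rw [ENNReal.toReal_ofReal (by positivity), ← div_pow, Real.sqrt_sq_eq_abs]

/-- The law of large numbers for the number of small jumps in `(a, a + h]`. -/
lemma IsSubordinator.ae_tendsto_jumpsIn_div (hS : IsSubordinator S ν P)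
    (hG : IsRegVarying (fun y => ν.real (Ici y)) α) (a h : ℝ≥0) :
    ∀ᵐ ω ∂P, Tendsto (fun y => (jumpsIn (fun t => S t ω) y a (a + h) : ℝ) / ν.real (Ici y))
      (𝓝[>] 0) (𝓝 h) := by
  -- For one ratio `r` the limit is located only up to the factors r^(±2α). Countably many ratios
  -- tending to 1 keep the exceptional set null.
  let r : ℕ → ℝ := fun j => 1 - 1 / ((j : ℝ) + 2)
  have hr0 : ∀ j, 0 < r j := fun j => by
    have : (1 : ℝ) / ((j : ℝ) + 2) < 1 := by
      rw [div_lt_one (by positivity)]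
      have : (0 : ℝ) ≤ j := Nat.cast_nonneg j
      linarith
    simp only [r]
    linarith
  have hr1 : ∀ j, r j < 1 := fun j => by
    have : (0 : ℝ) < 1 / ((j : ℝ) + 2) := by positivity
    simp only [r]
    linarith
  have hrlim : Tendsto r atTop (𝓝 1) := by
    have h1 : Tendsto (fun j : ℕ => (1 : ℝ) / ((j : ℝ) + 2)) atTop (𝓝 0) :=
      (tendsto_const_nhds (x := (1 : ℝ))).div_atTop
        (tendsto_atTop_add_const_right _ _ tendsto_natCast_atTop_atTop)
    simpa [r] using h1.const_sub 1
  have hpow : ∀ γ : ℝ, Tendsto (fun j => (h : ℝ) * (r j ^ γ * r j ^ γ)) atTop (𝓝 h) := fun γ => by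
    have h1 : Tendsto (fun j => r j ^ γ) atTop (𝓝 1) := by
      simpa using hrlim.rpow_const (p := γ) (Or.inl one_ne_zero)
    simpa using (h1.mul h1).const_mul (h : ℝ)
  choose m hm1 hm2 hm3 using fun j => hS.exists_lintegral_deviation_le hG (hr0 j) (hr1 j) a h
  have hfin : ∀ᵐ ω ∂P, ∀ j, deviation ν (fun t => S t ω) (r j) (m j) a h < ∞ :=
    ae_all_iff.2 fun j => hS.ae_deviation_lt_top (hr0 j) (hm3 j)
  filter_upwards [hfin, hS.monotone] with ω hω hmono
  have key : ∀ j, ∀ l u : ℝ, l < h * (r j ^ α * r j ^ α) → h * (r j ^ (-α) * r j ^ (-α)) < u →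
      ∀ᶠ y in 𝓝[>] 0, l < (jumpsIn (fun t => S t ω) y a (a + h) : ℝ) / ν.real (Ici y) ∧
        (jumpsIn (fun t => S t ω) y a (a + h) : ℝ) / ν.real (Ici y) < u := fun j l u hl hu =>
    hG.eventually_mem_of_geometric (hr0 j) (hr1 j)
      (N := fun y => (jumpsIn (fun t => S t ω) y a (a + h) : ℝ)) (fun y => Nat.cast_nonneg _)
      (fun y y' hy hyy' => by exact_mod_cast jumpsIn_anti hmono hy hyy' _ _) (hm1 j) (hm2 j)
      (tendsto_of_deviation_lt_top (hω j)) hl hu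
  refine tendsto_order.2 ⟨fun l hl => ?_, fun u hu => ?_⟩
  · obtain ⟨j, hj⟩ := ((hpow α).eventually (lt_mem_nhds hl)).exists
    filter_upwards [key j l _ hj (lt_add_one _)] with y hy using hy.1
  · obtain ⟨j, hj⟩ := ((hpow (-α)).eventually (gt_mem_nhds hu)).exists
    filter_upwards [key j _ u (sub_one_lt _) hj] with y hy using hy.2

/-- The normalized numbers of jumps of the multiplicative subordinator in `(k, k + 1]` have a
dominating sequence with integrable sum. -/
lemma IsSubordinator.exists_dominating (hS : IsSubordinator S ν P)
    (hG : IsRegVarying (fun y => ν.real (Ici y)) α) :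
    ∃ y₀ > 0, ∃ D : ℕ → Ω → ℝ≥0∞, (∀ k, AEMeasurable (D k) P) ∧ ∫⁻ ω, ∑' k, D k ω ∂P < ∞ ∧
      ∀ᵐ ω ∂P, ∀ k : ℕ, ∀ x, 0 < x → x ≤ y₀ → ENNReal.ofReal
        ((jumpsIn (expPath fun t => S t ω) x k (k + 1) : ℝ) / ν.real (Ici x)) ≤ D k ω := by
  have hr0 : (0 : ℝ) < 1 / 2 := by norm_num
  have hr1 : (1 / 2 : ℝ) < 1 := by norm_num
  have hα := hG.index_pos
  obtain ⟨y₁, hy₁, hpot⟩ := hG.exists_potter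
  obtain ⟨C, hC, y₂, hy₂, hdom⟩ := hG.exists_le_mul_of_geometric (h := ((1 : ℝ≥0) : ℝ)) zero_le_one
  obtain ⟨y₃, hy₃, hpos⟩ := mem_nhdsGT_iff_exists_Ioo_subset.1 hG.eventually_pos
  -- `y₁` and 1 serve the Potter bound, `y₂` the geometric control, and halving `y₃` keeps `x ≤ y₀`
  -- inside the open interval where the tail is positive.
  set y₀ := min (min y₁ y₂) (min 1 (y₃ / 2)) with hy₀
  have hy₃' : 0 < y₃ := hy₃
  have hy00 : 0 < y₀ := lt_min (lt_min hy₁ hy₂) (lt_min one_pos (half_pos hy₃'))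
  obtain ⟨C', hC', hpot⟩ := hpot y₀ hy00 ((min_le_left _ _).trans (min_le_left _ _))
    ((min_le_right _ _).trans (min_le_left _ _))
  choose m hm1 hm2 hm3 using fun k : ℕ => hS.exists_lintegral_deviation_le hG hr0 hr1 k 1
  set K := ((1 : ℝ≥0) : ℝ) * ∑' n : ℕ, ν.real (Ici ((1 / 2 : ℝ) ^ (n + 1))) /
    ν.real (Ici ((1 / 2 : ℝ) ^ n)) ^ 2 with hK
  let Z : ℕ → Ω → ℝ≥0∞ := fun k ω => deviation ν (fun t => S t ω) (1 / 2) (m k) k 1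
  have hZm : ∀ k, AEMeasurable (Z k) P := fun k => hS.aemeasurable_deviation hr0 _ _ _
  let W : ℕ → Ω → ℝ≥0∞ := fun k ω => ENNReal.ofReal (Real.exp (-(α / 2) * S k ω))
  have hWm : ∀ k, Measurable (W k) := fun k => by have := hS.measurable k; fun_prop
  have hDm : ∀ k, AEMeasurable (fun ω => ENNReal.ofReal (C * C') * (W k ω + W k ω * Z k ω)) P :=
    fun k => ((hWm k).aemeasurable.add ((hWm k).aemeasurable.mul (hZm k))).const_mul _
  refine ⟨y₀, hy00, fun k ω => ENNReal.ofReal (C * C') * (W k ω + W k ω * Z k ω), hDm, ?_, ?_⟩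
  · rw [lintegral_tsum hDm]
    have hq : Real.exp (-laplaceExponent ν (α / 2)) < 1 := by
      rw [Real.exp_lt_one_iff]
      linarith [hS.laplaceExponent_pos hG (half_pos hα)]
    set q := ENNReal.ofReal (Real.exp (-laplaceExponent ν (α / 2))) with hqdef
    have hqk : ∀ k : ℕ, ENNReal.ofReal (Real.exp (-((k : ℝ≥0) : ℝ) *
        laplaceExponent ν (α / 2))) = q ^ k := fun k => by
      rw [hqdef, ← ENNReal.ofReal_pow (Real.exp_pos _).le, ← Real.exp_nat_mul]
      congr 2
      push_cast
      ring
    -- Both `W k` and `W k * Z k` have expectation at most a constant times `q ^ k`, the constant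
    -- being independent of `k`.
    have hterm : ∀ k : ℕ, ∫⁻ ω, ENNReal.ofReal (C * C') * (W k ω + W k ω * Z k ω) ∂P ≤
        ENNReal.ofReal (C * C') * (1 + ENNReal.ofReal K) * q ^ k := fun k => by
      rw [lintegral_const_mul' _ _ ENNReal.ofReal_ne_top, lintegral_add_left (hWm k)]
      have h1 := hS.lintegral_exp k (half_pos hα).le
      have h2 := hm3 k (α / 2) (half_pos hα).le
      rw [hqk] at h1 h2
      rw [mul_assoc]
      refine mul_le_mul_right ?_ _
      rw [add_mul, one_mul, mul_comm (ENNReal.ofReal K)]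
      exact add_le_add h1.le h2
    refine lt_of_le_of_lt (ENNReal.tsum_le_tsum hterm) ?_
    rw [ENNReal.tsum_mul_left, ENNReal.tsum_geometric]
    refine ENNReal.mul_lt_top (ENNReal.mul_lt_top ENNReal.ofReal_lt_top
      (ENNReal.add_lt_top.2 ⟨ENNReal.one_lt_top, ENNReal.ofReal_lt_top⟩)) ?_
    rw [ENNReal.inv_lt_top, tsub_pos_iff_lt, hqdef, ← ENNReal.ofReal_one]
    exact (ENNReal.ofReal_lt_ofReal_iff one_pos).2 hq
  · have hfin : ∀ᵐ ω ∂P, ∀ k, Z k ω < ∞ :=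
      ae_all_iff.2 fun k => hS.ae_deviation_lt_top hr0 (hm3 k)
    filter_upwards [hfin, hS.monotone, hS.ae_nonneg] with ω hω hmono hnn k x hx hxy
    have hGx : 0 < ν.real (Ici x) := hpos ⟨hx, by
      have : y₀ ≤ y₃ / 2 := (min_le_right _ _).trans (min_le_right _ _)
      linarith⟩
    have hE : ENNReal.ofReal (C * C') * (W k ω + W k ω * Z k ω) = ENNReal.ofReal
        (C * C' * (Real.exp (-(α / 2) * S k ω) * (1 + (Z k ω).toReal))) := by
      rw [ENNReal.ofReal_mul (p := C * C') (by positivity), ENNReal.ofReal_mul (Real.exp_pos _).le,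
        ENNReal.ofReal_add zero_le_one ENNReal.toReal_nonneg, ENNReal.ofReal_toReal (hω k).ne,
        ENNReal.ofReal_one]
      exact congrArg _ (mul_one_add _ _).symm
    rw [hE]
    refine ENNReal.ofReal_le_ofReal ?_
    rw [div_le_iff₀ hGx]
    have hZ0 : 0 ≤ (Z k ω).toReal := ENNReal.toReal_nonneg
    -- Past level 1 no jump of size `x` fits any more. Below it, the threshold is capped at `y₀` to
    -- reach the range of the uniform bound, and the Potter bound returns from the capped level to
    -- `x`.
    rcases le_or_gt (x * Real.exp (S k ω)) 1 with hz | hz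
    · have hxz : x ≤ x * Real.exp (S k ω) :=
        le_mul_of_one_le_right hx.le (Real.one_le_exp (hnn k))
      set w := min (x * Real.exp (S k ω)) y₀ with hw
      have hw0 : 0 < w := lt_min (by positivity) hy00
      have h1 : (jumpsIn (expPath fun t => S t ω) x k (k + 1) : ℝ) ≤
          jumpsIn (fun t => S t ω) w k (k + 1) := by
        exact_mod_cast (jumpsIn_expPath_le hmono hx _ _).trans
          (jumpsIn_anti hmono hw0 (min_le_left _ _) _ _)
      have h2 := hdom (fun y => (jumpsIn (fun t => S t ω) y k (k + 1) : ℝ))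
        (fun y y' hy hyy' => by exact_mod_cast jumpsIn_anti hmono hy hyy' _ _) (m k) (hm2 k)
        (Z k ω).toReal (fun n => div_sq_le_toReal_deviation (hω k) n) w hw0
        ((min_le_right _ _).trans ((min_le_left _ _).trans (min_le_right _ _)))
      have h3 := hpot x _ hx hxy hxz hz
      rw [mul_div_cancel_left₀ _ hx.ne', ← Real.exp_mul] at h3
      calc _ ≤ _ := h1
        _ ≤ _ := h2
        _ ≤ C * (1 + (Z k ω).toReal) *
            (C' * Real.exp (S k ω * -(α / 2)) * ν.real (Ici x)) := by gcongr
        _ = _ := by rw [mul_comm (S k ω), neg_mul]; ring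
    · rw [jumpsIn_expPath_eq_zero hmono _ hz, Nat.cast_zero]
      positivity

end Probabilistic

/-! ### From the jump density of a path to the counts for 1 - exp(-f) -/

section Path

variable {f : ℝ≥0 → ℝ} {G : ℝ → ℝ} {α : ℝ}

/-- The limit law for the numbers of jumps in `(a, b]`, `0 ≤ a ≤ b`. -/
def HasJumpDensity (f : ℝ≥0 → ℝ) (G : ℝ → ℝ) : Prop :=
  ∀ a b : ℝ≥0, a ≤ b → Tendsto (fun y => (jumpsIn f y a b : ℝ) / G y) (𝓝[>] 0) (𝓝 ((b : ℝ) - a))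

/-- The counts are monotone in the endpoint and the limit is continuous in it, so rational endpoints
suffice and one null set serves all times. -/
lemma hasJumpDensity_of_rat (hG : IsRegVarying G α) (hf : Monotone f)
    (h : ∀ q : ℚ, Tendsto (fun y => (jumpsIn f y 0 (Real.toNNReal q) : ℝ) / G y) (𝓝[>] 0)
      (𝓝 (Real.toNNReal q))) : HasJumpDensity f G := by
  have hmono : ∀ y > 0, ∀ s t : ℝ≥0, s ≤ t →
      (jumpsIn f y 0 s : ℝ) / G y ≤ (jumpsIn f y 0 t : ℝ) / G y := fun y hy s t hst => by
    refine div_le_div_of_nonneg_right ?_ (hG.nonneg y)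
    exact_mod_cast (jumpsIn_add hf hy zero_le hst).symm ▸ Nat.le_add_right _ _
  have hzero : ∀ t : ℝ≥0, Tendsto (fun y => (jumpsIn f y 0 t : ℝ) / G y) (𝓝[>] 0) (𝓝 t) := by
    intro t
    refine tendsto_order.2 ⟨fun l hl => ?_, fun u hu => ?_⟩
    · rcases lt_or_ge l 0 with h0 | h0
      · refine Eventually.of_forall fun y => h0.trans_le ?_
        exact div_nonneg (Nat.cast_nonneg _) (hG.nonneg y)
      · have hl' : (⟨l, h0⟩ : ℝ≥0) < t := hl
        obtain ⟨q, -, h1, h2⟩ := (NNReal.lt_iff_exists_rat_btwn _ _).1 hl'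
        filter_upwards [(h q).eventually (lt_mem_nhds (show l < _ from h1)), self_mem_nhdsWithin]
          with y hy hy0
        exact hy.trans_le (hmono y hy0 _ _ h2.le)
    · have h0 : 0 ≤ u := t.coe_nonneg.trans hu.le
      have hu' : t < (⟨u, h0⟩ : ℝ≥0) := hu
      obtain ⟨q, -, h1, h2⟩ := (NNReal.lt_iff_exists_rat_btwn _ _).1 hu'
      filter_upwards [(h q).eventually (gt_mem_nhds (show _ < u from h2)), self_mem_nhdsWithin]
        with y hy hy0
      exact (hmono y hy0 _ _ h1.le).trans_lt hy
  intro a b hab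
  refine ((hzero b).sub (hzero a)).congr' ?_
  filter_upwards [self_mem_nhdsWithin] with y hy
  rw [← sub_div, ← jumpsIn_add hf hy zero_le hab]
  push_cast
  ring

lemma HasJumpDensity.tendsto_scaled (h : HasJumpDensity f G) (hG : IsRegVarying G α) (s : ℝ)
    {a b : ℝ≥0} (hab : a ≤ b) :
    Tendsto (fun x => (jumpsIn f (x * Real.exp s) a b : ℝ) / G x) (𝓝[>] 0)
      (𝓝 (((b : ℝ) - a) * Real.exp (-α * s))) := by
  have hc := Real.exp_pos s
  have h1 := ((h a b hab).comp (tendsto_const_mul_nhdsGT_zero hc)).mul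
    (hG.tendsto_ratio _ hc)
  rw [← Real.exp_mul, mul_comm s] at h1
  refine h1.congr' ?_
  filter_upwards [(tendsto_const_mul_nhdsGT_zero hc).eventually hG.eventually_pos] with x hx
  rw [Function.comp_apply, div_mul_div_cancel₀ hx.ne', mul_comm x]

lemma antitone_exp_neg_mul (hf : Monotone f) (hα : 0 < α) :
    Antitone fun u : ℝ => Real.exp (-α * f u.toNNReal) := fun u v huv => by
  have := hf (Real.toNNReal_le_toNNReal huv)
  exact Real.exp_le_exp.2 (by nlinarith)

/-- The area under the path `exp (-α f)` over `[a, b]`. -/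
def pathArea (f : ℝ≥0 → ℝ) (α : ℝ) (a b : ℝ≥0) : ℝ :=
  ∫ u in (a : ℝ)..b, Real.exp (-α * f u.toNNReal)

lemma pathArea_add (hf : Monotone f) (hα : 0 < α) (a b c : ℝ≥0) :
    pathArea f α a b + pathArea f α b c = pathArea f α a c :=
  intervalIntegral.integral_add_adjacent_intervals
    (antitone_exp_neg_mul hf hα).intervalIntegrable (antitone_exp_neg_mul hf hα).intervalIntegrable

lemma pathArea_le (hf : Monotone f) (hα : 0 < α) {a b : ℝ≥0} (hab : a ≤ b) :
    pathArea f α a b ≤ ((b : ℝ) - a) * Real.exp (-α * f a) := by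
  have hanti := antitone_exp_neg_mul hf hα
  have hab' : (a : ℝ) ≤ b := hab
  have := intervalIntegral.integral_mono_on (μ := volume) hab' hanti.intervalIntegrable
    (intervalIntegrable_const (c := Real.exp (-α * f a))) fun u hu => by
      simpa using hanti hu.1
  simpa [pathArea] using this

lemma le_pathArea (hf : Monotone f) (hα : 0 < α) {a b : ℝ≥0} (hab : a ≤ b) :
    ((b : ℝ) - a) * Real.exp (-α * f b) ≤ pathArea f α a b := by
  have hanti := antitone_exp_neg_mul hf hα
  have hab' : (a : ℝ) ≤ b := hab
  have := intervalIntegral.integral_mono_on (μ := volume) hab'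
    (intervalIntegrable_const (c := Real.exp (-α * f b))) hanti.intervalIntegrable fun u hu => by
      simpa using hanti hu.2
  simpa [pathArea] using this

lemma jumpsIn_eq_sum (hf : Monotone f) {y : ℝ} (hy : 0 < y) (a h : ℝ≥0) (n : ℕ) (k : ℕ) :
    jumpsIn f y a (gridPoint a h n k) =
      ∑ i ∈ Finset.range k, jumpsIn f y (gridPoint a h n i) (gridPoint a h n (i + 1)) := by
  induction k with
  | zero => simp [jumpsIn]
  | succ k ih =>
    rw [Finset.sum_range_succ, ← ih, jumpsIn_add hf hy _ (gridPoint_mono a h n (Nat.le_succ k))]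
    simpa using gridPoint_mono a h n (Nat.zero_le k)

lemma pathArea_eq_sum (hf : Monotone f) (hα : 0 < α) (a h : ℝ≥0) (n : ℕ) (k : ℕ) :
    pathArea f α a (gridPoint a h n k) =
      ∑ i ∈ Finset.range k, pathArea f α (gridPoint a h n i) (gridPoint a h n (i + 1)) := by
  induction k with
  | zero => simp [pathArea]
  | succ k ih => rw [Finset.sum_range_succ, ← ih, pathArea_add hf hα]

/-- Convergence of the normalized numbers of jumps of `1 - exp (-f)` in a bounded interval. -/
lemma HasJumpDensity.tendsto_jumpsIn_expPath (h : HasJumpDensity f G) (hG : IsRegVarying G α)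
    (hf : Monotone f) (h0 : ∀ t, 0 ≤ f t) {a b : ℝ≥0} (hab : a ≤ b) :
    Tendsto (fun x => (jumpsIn (expPath f) x a b : ℝ) / G x) (𝓝[>] 0) (𝓝 (pathArea f α a b)) := by
  have hα := hG.index_pos
  set t := b - a with ht
  have hatb : a + t = b := add_tsub_cancel_of_le hab
  have hgap : ∀ n i, ((gridPoint a t n (i + 1) : ℝ≥0) : ℝ) - gridPoint a t n i = t / n :=
    fun n i => by rw [gridPoint_succ]; push_cast; ring
  let e : ℕ → ℕ → ℝ := fun n i => Real.exp (-α * f (gridPoint a t n i))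
  have he : ∀ n i, 0 < e n i ∧ e n i ≤ 1 := fun n i =>
    ⟨Real.exp_pos _, Real.exp_le_one_iff.2 (by nlinarith [h0 (gridPoint a t n i)])⟩
  -- The upper and lower Riemann sums of a decreasing function with values in [0, 1] telescope to a
  -- difference of at most one mesh.
  have hdiff : ∀ n : ℕ, ∑ i ∈ Finset.range n, (t / n : ℝ) * e n i ≤
      ∑ i ∈ Finset.range n, (t / n : ℝ) * e n (i + 1) + t / n := fun n => by
    rw [← Finset.mul_sum, ← Finset.mul_sum, ← mul_add_one]
    refine mul_le_mul_of_nonneg_left ?_ (by positivity)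
    have h1 := Finset.sum_range_sub (e n) n
    rw [Finset.sum_sub_distrib] at h1
    linarith [he n 0, he n n]
  have harea : ∀ n : ℕ, n ≠ 0 → ∑ i ∈ Finset.range n, (t / n : ℝ) * e n (i + 1) ≤
      pathArea f α a b ∧ pathArea f α a b ≤ ∑ i ∈ Finset.range n, (t / n : ℝ) * e n i :=
    fun n hn => by
      rw [← hatb, ← gridPoint_self a t hn, pathArea_eq_sum hf hα]
      constructor
      · refine Finset.sum_le_sum fun i _ => ?_
        rw [← hgap n i]
        exact le_pathArea hf hα (gridPoint_mono a t n (Nat.le_succ i))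
      · refine Finset.sum_le_sum fun i _ => ?_
        rw [← hgap n i]
        exact pathArea_le hf hα (gridPoint_mono a t n (Nat.le_succ i))
  have hup : ∀ n : ℕ, Tendsto (fun x => ∑ i ∈ Finset.range n,
      (jumpsIn f (x * Real.exp (f (gridPoint a t n i))) (gridPoint a t n i)
        (gridPoint a t n (i + 1)) : ℝ) / G x) (𝓝[>] 0)
      (𝓝 (∑ i ∈ Finset.range n, (t / n : ℝ) * e n i)) := fun n =>
    tendsto_finsetSum _ fun i _ => by
      rw [← hgap n i]
      exact h.tendsto_scaled hG _ (gridPoint_mono a t n (Nat.le_succ i))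
  have hlow : ∀ n : ℕ, Tendsto (fun x => ∑ i ∈ Finset.range n,
      (jumpsIn f (x * Real.exp (f (gridPoint a t n (i + 1)))) (gridPoint a t n i)
        (gridPoint a t n (i + 1)) : ℝ) / G x) (𝓝[>] 0)
      (𝓝 (∑ i ∈ Finset.range n, (t / n : ℝ) * e n (i + 1))) := fun n =>
    tendsto_finsetSum _ fun i _ => by
      rw [← hgap n i]
      exact h.tendsto_scaled hG _ (gridPoint_mono a t n (Nat.le_succ i))
  have hmesh : Tendsto (fun n : ℕ => (t : ℝ) / n) atTop (𝓝 0) :=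
    tendsto_const_div_atTop_nhds_zero_nat _
  have hcount : ∀ n : ℕ, n ≠ 0 → ∀ x > 0, (jumpsIn (expPath f) x a b : ℝ) / G x =
      ∑ i ∈ Finset.range n, (jumpsIn (expPath f) x (gridPoint a t n i)
        (gridPoint a t n (i + 1)) : ℝ) / G x := fun n hn x hx => by
    rw [← hatb, ← gridPoint_self a t hn, jumpsIn_eq_sum (expPath_mono hf) hx, Nat.cast_sum,
      Finset.sum_div]
  refine tendsto_order.2 ⟨fun l hl => ?_, fun u hu => ?_⟩
  · obtain ⟨n, hn1, hn⟩ := ((hmesh.eventually (gt_mem_nhds (sub_pos.2 hl))).and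
      (eventually_ne_atTop 0)).exists
    have h1 := hdiff n
    have h2 := harea n hn
    filter_upwards [(hlow n).eventually (lt_mem_nhds (show l < _ by linarith)),
      self_mem_nhdsWithin] with x hx hx0
    refine hx.trans_le ?_
    rw [hcount n hn x hx0]
    refine Finset.sum_le_sum fun i _ => div_le_div_of_nonneg_right ?_ (hG.nonneg x)
    exact_mod_cast le_jumpsIn_expPath hf hx0 _ _
  · obtain ⟨n, hn1, hn⟩ := ((hmesh.eventually (gt_mem_nhds (sub_pos.2 hu))).and
      (eventually_ne_atTop 0)).exists
    have h1 := hdiff n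
    have h2 := harea n hn
    filter_upwards [(hup n).eventually (gt_mem_nhds (show _ < u by linarith)),
      self_mem_nhdsWithin] with x hx hx0
    refine lt_of_le_of_lt ?_ hx
    rw [hcount n hn x hx0]
    refine Finset.sum_le_sum fun i _ => div_le_div_of_nonneg_right ?_ (hG.nonneg x)
    exact_mod_cast jumpsIn_expPath_le hf hx0 _ _

lemma sum_jumpsIn_nat (hf : Monotone f) {x : ℝ} (hx : 0 < x) (n : ℕ) :
    ∑ k ∈ Finset.range n, jumpsIn f x k (k + 1) = jumpsIn f x 0 n := by
  induction n with
  | zero => simp [jumpsIn]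
  | succ n ih =>
    rw [Finset.sum_range_succ, ih, jumpsIn_add hf hx zero_le le_self_add, Nat.cast_succ]

lemma sum_pathArea_nat (hf : Monotone f) (hα : 0 < α) (n : ℕ) :
    ∑ k ∈ Finset.range n, pathArea f α k (k + 1) = pathArea f α 0 n := by
  induction n with
  | zero => simp [pathArea]
  | succ n ih => rw [Finset.sum_range_succ, ih, pathArea_add hf hα, Nat.cast_succ]

lemma hasSum_jumpsIn_expPath (hf : Monotone f) (h0 : ∀ t, 0 ≤ f t) (hG : IsRegVarying G α) {x : ℝ}
    (hx : 0 < x) : HasSum (fun k : ℕ => (jumpsIn (expPath f) x k (k + 1) : ℝ) / G x)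
      ((jumpTimes (expPath f) x).ncard / G x) := by
  rw [hasSum_iff_tendsto_nat_of_nonneg fun k => div_nonneg (Nat.cast_nonneg _) (hG.nonneg x)]
  refine tendsto_const_nhds.congr' ?_
  filter_upwards [eventually_jumpsIn_expPath_eq hf h0 hx] with n hn
  rw [← hn, ← sum_jumpsIn_nat (expPath_mono hf) hx, Nat.cast_sum, Finset.sum_div]

/-- Dominated convergence of the normalized total number of jumps of `1 - exp (-f)`. -/
lemma HasJumpDensity.tendsto_ncard (h : HasJumpDensity f G) (hG : IsRegVarying G α)
    (hf : Monotone f) (h0 : ∀ t, 0 ≤ f t) {D : ℕ → ℝ} (hD : Summable D) {y₀ : ℝ} (hy₀ : 0 < y₀)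
    (hb : ∀ k : ℕ, ∀ x, 0 < x → x ≤ y₀ → (jumpsIn (expPath f) x k (k + 1) : ℝ) / G x ≤ D k) :
    IntegrableOn (fun u : ℝ => Real.exp (-α * f u.toNNReal)) (Ioi 0) ∧
    Tendsto (fun x => ((jumpTimes (expPath f) x).ncard : ℝ) / G x) (𝓝[>] 0)
      (𝓝 (∫ u in Ioi (0 : ℝ), Real.exp (-α * f u.toNNReal))) := by
  have hα := hG.index_pos
  have hanti := antitone_exp_neg_mul hf hα
  have hk : ∀ k : ℕ, Tendsto (fun x => (jumpsIn (expPath f) x k (k + 1) : ℝ) / G x) (𝓝[>] 0)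
      (𝓝 (pathArea f α k (k + 1))) := fun k =>
    h.tendsto_jumpsIn_expPath hG hf h0 le_self_add
  have hmem : Ioc 0 y₀ ∈ 𝓝[>] (0 : ℝ) := Ioc_mem_nhdsGT hy₀
  have hA0 : ∀ k : ℕ, 0 ≤ pathArea f α k (k + 1) := fun k =>
    ge_of_tendsto' (hk k) fun x => div_nonneg (Nat.cast_nonneg _) (hG.nonneg x)
  have hAD : ∀ k : ℕ, pathArea f α k (k + 1) ≤ D k := fun k => by
    refine le_of_tendsto (hk k) ?_
    filter_upwards [hmem] with x hx using hb k x hx.1 hx.2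
  have hsumA : Summable fun k : ℕ => pathArea f α k (k + 1) := hD.of_nonneg_of_le hA0 hAD
  -- Each unit area is a limit of normalized counts and so inherits the bound `D k`; finiteness of
  -- the whole area is thus a by-product.
  have hint : IntegrableOn (fun u : ℝ => Real.exp (-α * f u.toNNReal)) (Ioi 0) := by
    refine integrableOn_Ioi_of_intervalIntegral_norm_bounded (∑' k, D k) 0
      (fun n : ℕ => (hanti.intervalIntegrable (a := 0) (b := n)).1)
      tendsto_natCast_atTop_atTop (Eventually.of_forall fun n => ?_)
    simp only [Real.norm_of_nonneg (Real.exp_pos _).le]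
    have h1 := sum_pathArea_nat hf hα n
    simp only [pathArea, NNReal.coe_zero, NNReal.coe_natCast] at h1
    rw [← h1]
    exact (Finset.sum_le_sum fun k _ => hAD k).trans
      (hD.sum_le_tsum _ fun k _ => (hA0 k).trans (hAD k))
  refine ⟨hint, ?_⟩
  have hA : HasSum (fun k : ℕ => pathArea f α k (k + 1))
      (∫ u in Ioi (0 : ℝ), Real.exp (-α * f u.toNNReal)) := by
    rw [hasSum_iff_tendsto_nat_of_nonneg hA0]
    refine (intervalIntegral_tendsto_integral_Ioi 0 hint tendsto_natCast_atTop_atTop).congr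
      fun n => ?_
    rw [sum_pathArea_nat hf hα, pathArea]
    simp
  rw [← hA.tsum_eq]
  have hdom := tendsto_tsum_of_dominated_convergence hD hk (by
    filter_upwards [hmem] with x hx k
    rw [Real.norm_of_nonneg (div_nonneg (Nat.cast_nonneg _) (hG.nonneg x))]
    exact hb k x hx.1 hx.2)
  refine hdom.congr' ?_
  filter_upwards [self_mem_nhdsWithin] with x hx
  exact (hasSum_jumpsIn_expPath hf h0 hG hx).tsum_eq

end Path

/-! ### Convergence in the mean -/

lemma tendstoInMean_of_dominated {Ω : Type*} [MeasurableSpace Ω] {P : Measure Ω}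
    {X : ℝ → Ω → ℝ} {Y T : Ω → ℝ} (hX : ∀ x, 0 < x → Integrable (X x) P) (hT : Integrable T P)
    {y₀ : ℝ} (hy₀ : 0 < y₀) (hb : ∀ᵐ ω ∂P, ∀ x, 0 < x → x ≤ y₀ → |X x ω| ≤ T ω)
    (hlim : ∀ᵐ ω ∂P, Tendsto (fun x => X x ω) (𝓝[>] 0) (𝓝 (Y ω))) : TendstoInMean X Y P := by
  have hmem : Ioc 0 y₀ ∈ 𝓝[>] (0 : ℝ) := Ioc_mem_nhdsGT hy₀
  have hYb : ∀ᵐ ω ∂P, |Y ω| ≤ T ω := by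
    filter_upwards [hb, hlim] with ω h1 h2
    refine le_of_tendsto h2.abs ?_
    filter_upwards [hmem] with x hx using h1 x hx.1 hx.2
  -- A sequence of levels gives the measurability of `Y`.
  have hseq : Tendsto (fun n : ℕ => 1 / ((n : ℝ) + 1)) atTop (𝓝[>] 0) :=
    tendsto_nhdsWithin_iff.2 ⟨tendsto_one_div_add_atTop_nhds_zero_nat,
      Eventually.of_forall fun n => mem_Ioi.2 Nat.one_div_pos_of_nat⟩
  have hYm : AEStronglyMeasurable Y P :=
    aestronglyMeasurable_of_tendsto_ae atTop
      (fun n : ℕ => (hX _ (Nat.one_div_pos_of_nat (n := n))).aestronglyMeasurable)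
      (by filter_upwards [hlim] with ω hω using hω.comp hseq)
  have hY : Integrable Y P := hT.mono' hYm hYb
  refine ⟨hX, hY, ?_⟩
  have h0 : Tendsto (fun x => ∫ ω, |X x ω - Y ω| ∂P) (𝓝[>] 0) (𝓝 (∫ _, (0 : ℝ) ∂P)) := by
    refine tendsto_integral_filter_of_dominated_convergence (fun ω => T ω + T ω) ?_ ?_
      (hT.add hT) ?_
    · filter_upwards [self_mem_nhdsWithin] with x hx
      exact ((hX x hx).sub hY).abs.aestronglyMeasurable
    · filter_upwards [hmem] with x hx
      filter_upwards [hb, hYb] with ω h1 h2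
      rw [Real.norm_of_nonneg (abs_nonneg _)]
      exact (abs_sub _ _).trans (add_le_add (h1 x hx.1 hx.2) h2)
    · filter_upwards [hlim] with ω hω
      simpa using (hω.sub_const (Y ω)).abs
  simpa using h0

end GapCount

end

/-! ### The theorem -/

open GapCount in
theorem theorem5p1 {Ω : Type*} [MeasurableSpace Ω] (P : Measure Ω) [IsProbabilityMeasure P]
    (S : ℝ≥0 → Ω → ℝ) (ν : Measure ℝ) (α : ℝ) (ℓ : ℝ → ℝ)
    (hS : GapCount.IsSubordinator S ν P) (hν : GapCount.HasRegVaryingTail ν α ℓ) :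
    -- almost surely, the counts are finite and the integral defining the limit converges
    (∀ᵐ ω ∂P, ∀ x : ℝ, 0 < x →
      (GapCount.jumpTimes (fun s => GapCount.multiplicative S s ω) x).Finite) ∧
    (∀ᵐ ω ∂P, IntegrableOn (fun u : ℝ => Real.exp (-α * S u.toNNReal ω)) (Ioi 0)) ∧
    -- almost sure convergence
    (∀ᵐ ω ∂P, ∀ t : ℝ≥0,
      Tendsto (fun x => (GapCount.jumpCountUpTo S x t ω : ℝ) / GapCount.scaling α ℓ x)
        (𝓝[>] 0) (𝓝 (GapCount.areaUpTo S α t ω))) ∧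
    (∀ᵐ ω ∂P,
      Tendsto (fun x => (GapCount.jumpCount S x ω : ℝ) / GapCount.scaling α ℓ x)
        (𝓝[>] 0) (𝓝 (GapCount.area S α ω))) ∧
    -- convergence in the mean
    (∀ t : ℝ≥0, GapCount.TendstoInMean
      (fun x ω => (GapCount.jumpCountUpTo S x t ω : ℝ) / GapCount.scaling α ℓ x)
      (GapCount.areaUpTo S α t) P) ∧
    GapCount.TendstoInMean
      (fun x ω => (GapCount.jumpCount S x ω : ℝ) / GapCount.scaling α ℓ x)
      (GapCount.area S α) P := by
  have hG := hν.isRegVarying hS.levyMeasure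
  have hscale := hν.eventually_scaling_eq
  obtain ⟨y₁, hy₁, D, hDm, hDfin, hDdom⟩ := hS.exists_dominating hG
  obtain ⟨y₂, hy₂, hsc⟩ := mem_nhdsGT_iff_exists_Ioo_subset.1 hscale
  have hy₂' : 0 < y₂ := hy₂
  -- Up to `y₀` the domination holds and the scaling function is exactly the tail of `ν`.
  set y₀ := min y₁ (y₂ / 2) with hy₀def
  have hy₀ : 0 < y₀ := lt_min hy₁ (half_pos hy₂')
  have hsc' : ∀ x, 0 < x → x ≤ y₀ → scaling α ℓ x = ν.real (Ici x) := fun x hx hxy =>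
    hsc ⟨hx, by have : y₀ ≤ y₂ / 2 := min_le_right _ _; linarith⟩
  have hDae : ∀ᵐ ω ∂P, ∑' k, D k ω < ∞ := ae_lt_top' (AEMeasurable.tsum hDm) hDfin.ne
  have hdens : ∀ᵐ ω ∂P, HasJumpDensity (fun t => S t ω) (fun y => ν.real (Ici y)) := by
    have h1 : ∀ᵐ ω ∂P, ∀ q : ℚ, Tendsto (fun y =>
        (jumpsIn (fun t => S t ω) y 0 (Real.toNNReal q) : ℝ) / ν.real (Ici y)) (𝓝[>] 0)
        (𝓝 (Real.toNNReal q)) := ae_all_iff.2 fun q => by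
      simpa only [zero_add] using hS.ae_tendsto_jumpsIn_div hG 0 (Real.toNNReal q)
    filter_upwards [h1, hS.monotone] with ω h1 h2
    exact hasJumpDensity_of_rat hG h2 h1
  have hDreal : ∀ᵐ ω ∂P, Summable (fun k => (D k ω).toReal) ∧ ∀ k : ℕ, ∀ x, 0 < x → x ≤ y₀ →
      (jumpsIn (expPath fun t => S t ω) x k (k + 1) : ℝ) / ν.real (Ici x) ≤ (D k ω).toReal := by
    filter_upwards [hDae, hDdom] with ω h1 h2
    refine ⟨ENNReal.summable_toReal h1.ne, fun k x hx hxy => ?_⟩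
    refine (ENNReal.ofReal_le_iff_le_toReal (ENNReal.ne_top_of_tsum_ne_top h1.ne k)).1 ?_
    exact h2 k x hx (hxy.trans (min_le_left _ _))
  have htotal : ∀ᵐ ω ∂P,
      IntegrableOn (fun u : ℝ => Real.exp (-α * S u.toNNReal ω)) (Ioi 0) ∧
      Tendsto (fun x => (jumpCount S x ω : ℝ) / ν.real (Ici x)) (𝓝[>] 0) (𝓝 (area S α ω)) := by
    filter_upwards [hdens, hDreal, hS.monotone, hS.ae_nonneg] with ω h1 h2 h3 h4
    exact h1.tendsto_ncard hG h3 h4 h2.1 hy₀ h2.2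
  have hlim1 : ∀ᵐ ω ∂P, ∀ t : ℝ≥0,
      Tendsto (fun x => (jumpCountUpTo S x t ω : ℝ) / scaling α ℓ x) (𝓝[>] 0)
        (𝓝 (areaUpTo S α t ω)) := by
    filter_upwards [hdens, hS.monotone, hS.ae_nonneg] with ω h1 h2 h3 t
    refine (h1.tendsto_jumpsIn_expPath hG h2 h3 (zero_le : 0 ≤ t)).congr' ?_
    filter_upwards [hscale, self_mem_nhdsWithin] with x hx hx0
    rw [hx, ← ncard_jumpTimes_expPath_inter_Iic hx0]
    rfl
  have hlim2 : ∀ᵐ ω ∂P, Tendsto (fun x => (jumpCount S x ω : ℝ) / scaling α ℓ x) (𝓝[>] 0)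
      (𝓝 (area S α ω)) := by
    filter_upwards [htotal] with ω hω
    refine hω.2.congr' ?_
    filter_upwards [hscale] with x hx
    rw [hx]
  -- The deterministic bound `1 / x` gives integrability for every `x > 0`, also where the scaling
  -- function is unrelated to the tail.
  have hcount : ∀ᵐ ω ∂P, ∀ x, 0 < x → ∀ t, (jumpCountUpTo S x t ω : ℝ) ≤ jumpCount S x ω ∧
      (jumpCount S x ω : ℝ) ≤ 1 / x := by
    filter_upwards [hS.monotone, hS.ae_nonneg] with ω h1 h2 x hx t
    refine ⟨?_, ?_⟩
    · exact_mod_cast Set.ncard_le_ncard inter_subset_left (finite_jumpTimes_expPath h1 h2 hx)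
    · rw [le_div_iff₀ hx]
      exact ncard_jumpTimes_expPath_mul_le h1 h2 hx
  have hmeas1 : ∀ x, 0 < x → ∀ t, AEMeasurable (fun ω => (jumpCountUpTo S x t ω : ℝ)) P :=
    fun x hx t => by
      have h1 := aemeasurable_jumpsIn (P := P) (S := multiplicative S) (y := x) (a := 0) (b := t)
        (fun s => by have := hS.measurable s; unfold multiplicative; fun_prop)
        (by filter_upwards [hS.monotone] with ω hω using expPath_mono hω)
        (by filter_upwards [hS.right_continuous] with ω hω using expPath_right_continuous hω)
        hx zero_le
      refine h1.congr (ae_of_all _ fun ω => ?_)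
      exact congrArg _ (ncard_jumpTimes_expPath_inter_Iic (f := fun s => S s ω) hx t).symm
  have hmeas2 : ∀ x, 0 < x → AEMeasurable (fun ω => (jumpCount S x ω : ℝ)) P := fun x hx => by
    refine aemeasurable_of_tendsto_metrizable_ae atTop (fun k : ℕ => hmeas1 x hx k) ?_
    filter_upwards [hS.monotone, hS.ae_nonneg] with ω h1 h2
    refine tendsto_const_nhds.congr' ?_
    filter_upwards [eventually_jumpsIn_expPath_eq h1 h2 hx] with k hk
    exact congrArg _ (hk.symm.trans (ncard_jumpTimes_expPath_inter_Iic hx k).symm)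
  have hint1 : ∀ t x, 0 < x →
      Integrable (fun ω => (jumpCountUpTo S x t ω : ℝ) / scaling α ℓ x) P := fun t x hx => by
    refine (Integrable.of_bound (C := 1 / x) (hmeas1 x hx t).aestronglyMeasurable ?_).div_const _
    filter_upwards [hcount] with ω hω
    rw [Real.norm_of_nonneg (Nat.cast_nonneg _)]
    exact (hω x hx t).1.trans (hω x hx t).2
  have hint2 : ∀ x, 0 < x →
      Integrable (fun ω => (jumpCount S x ω : ℝ) / scaling α ℓ x) P := fun x hx => by
    refine (Integrable.of_bound (C := 1 / x) (hmeas2 x hx).aestronglyMeasurable ?_).div_const _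
    filter_upwards [hcount] with ω hω
    rw [Real.norm_of_nonneg (Nat.cast_nonneg _)]
    exact (hω x hx 0).2
  have hT : Integrable (fun ω => (∑' k, D k ω).toReal) P :=
    integrable_toReal_of_lintegral_ne_top (AEMeasurable.tsum hDm) hDfin.ne
  have hb2 : ∀ᵐ ω ∂P, ∀ x, 0 < x → x ≤ y₀ →
      (jumpCount S x ω : ℝ) / scaling α ℓ x ≤ (∑' k, D k ω).toReal := by
    filter_upwards [hDae, hDreal, hS.monotone, hS.ae_nonneg] with ω h1 h2 h3 h4 x hx hxy
    rw [hsc' x hx hxy, ENNReal.tsum_toReal_eq (ENNReal.ne_top_of_tsum_ne_top h1.ne)]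
    exact hasSum_le (fun k => h2.2 k x hx hxy)
      (hasSum_jumpsIn_expPath h3 h4 hG hx) h2.1.hasSum
  refine ⟨?_, ?_, hlim1, hlim2, fun t => ?_, ?_⟩
  · filter_upwards [hS.monotone, hS.ae_nonneg] with ω h1 h2 x hx
    exact finite_jumpTimes_expPath h1 h2 hx
  · filter_upwards [htotal] with ω hω using hω.1
  · refine tendstoInMean_of_dominated (hint1 t) hT hy₀ ?_ ?_
    · filter_upwards [hb2, hcount] with ω h1 h2 x hx hxy
      have hs : 0 ≤ scaling α ℓ x := by rw [hsc' x hx hxy]; exact measureReal_nonneg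
      rw [abs_of_nonneg (div_nonneg (Nat.cast_nonneg _) hs)]
      exact (div_le_div_of_nonneg_right (h2 x hx t).1 hs).trans (h1 x hx hxy)
    · filter_upwards [hlim1] with ω hω using hω t
  · refine tendstoInMean_of_dominated hint2 hT hy₀ ?_ hlim2
    filter_upwards [hb2] with ω h1 x hx hxy
    have hs : 0 ≤ scaling α ℓ x := by rw [hsc' x hx hxy]; exact measureReal_nonneg
    rw [abs_of_nonneg (div_nonneg (Nat.cast_nonneg _) hs)]
    exact h1 x hx hxy
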